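/- **Setting.** Let $\mathcal G=(V,E)$ be a finite connected simple undirected graph with $n$ nodes, let $S_0,S_1\subset V$ be disjoint nonempty sets ($0$-leaders and $1$-leaders), and let $F=V\setminus(S_0\cup S_1)\neq\emptyset$ be the set of followers, $N=|F|$. In the leader-follower DeGroot model, leaders in $S_0$ keep opinion $0$, leaders in $S_1$ keep opinion $1$, followers start from arbitrary real opinions, and at each time step every follower replaces its opinion by the average of the opinions of its neighbours; $x_i(\infty)$ is the limit of the opinion of node $i$. For $T\subseteq F\times S_1$ let $\mathcal G(T)=(V,E\cup T)$ and let $H(T)$ be the sum of $x_i(\infty)$ over $i\in F$ in $\mathcal G(T)$. Let $0<\epsilon<1/2$ and $1/2<\eta<1$, and let $Q\subseteq F\times S_1$ be a set of non-edges of $\mathcal G$ such that $x_i(\infty)<\eta$ in $\mathcal G$ for every $(i,a)\in Q$. Let $0\le k\le|Q|$ be an integer. **Solver.** Let $\textsc{Solve}$ be a randomized procedure (with discrete output distribution) such that, for some $p\ge 0$, for every positive definite matrix $S$ indexed by $F$, vector $y$ and $\delta>0$, the output $x=\textsc{Solve}(S,y,\delta)$ satisfies $\|x-S^{-1}y\|_S\le\delta\|S^{-1}y\|_S$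 with probability at least $1-p$, where $\|x\|_S=\sqrt{x^\top Sx}$. Different calls use independent randomness. **OpinionComp.** On a graph $\mathcal G'$ (one of the graphs $\mathcal G(T)$) and a set $R$ of candidate edges: let $L_F$ be the submatrix of the Laplacian of $\mathcal G'$ indexed by $F$; $b_i$ the number of neighbours of $i\in F$ in $S_1$; $W$ the diagonal matrix whose $i$-th entry is the number of neighbours of $i$ in $S_0\cup S_1$; $\bar B$ the $\bar m\times N$ signed incidence matrix of the subgraph induced on $F$, which has $\bar m$ edges. Put $\delta_1=\frac{\epsilon}{2n^2\sqrt{6(n^2-1)}}$, $\delta_2=\frac{(1-\eta)\epsilon}{n^2\sqrt{6(n^2-1)}}$, $\delta_3=\frac{\epsilon}{72n^2}\sqrt{\frac{6(1-\epsilon/12)}{(1+\epsilon/12)(n^2-1)}}$, $t=\lceil 24\log N/(\epsilon/12)^2\rceil$. Draw independent random matrices $P\in\mathbb R^{t\times\bar m}$ and $P'\in\mathbb R^{t\times N}$ with independent entries uniform in $\{1/\sqrt t,-1/\sqrt t\}$; compute $h=\textsc{Solve}(L_F,\mathbf 1,\delta_1)$, $q=\textsc{Solve}(L_F,b,\delta_2)$,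 and, for $1\le j\le t$, the rows $\tilde X_{[j,:]}=\textsc{Solve}(L_F,(P\bar B)_{[j,:]},\delta_3)$ and $\tilde Y_{[j,:]}=\textsc{Solve}(L_F,(P'W^{1/2})_{[j,:]},\delta_3)$. Return, for each $e=(i,a)\in R$, $$\tilde\Delta(e)=\frac{h_i(1-q_i)}{1+\|\tilde Xe_i\|^2+\|\tilde Ye_i\|^2}.$$ **Approx.** Start with $T=\emptyset$. For $k$ rounds, run OpinionComp (with fresh randomness) on $\mathcal G(T)$ and $Q\setminus T$, and add to $T$ an edge $e\in Q\setminus T$ that maximizes $\tilde\Delta(e)$, with an arbitrary fixed tie-breaking rule. Return $T$. **Theorem.** For every $T'\subseteq Q$ the opinions of all nodes in $\mathcal G(T')$ converge. Moreover, let $T^*$ maximize $H$ among all $k$-element subsets of $Q$. Then, with probability at least $$1-k\Big(\frac{4}{N^3}+(2t+2)p\Big),$$ the set $T$ returned by Approx is a $k$-element subset of $Q$ that satisfies $$H(T)-H(\emptyset)\ \ge\ \Big(1-\frac1e-\epsilon\Big)\big(H(T^*)-H(\emptyset)\big).$$ -/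

import Mathlib

open Filter Topology Matrix

noncomputable section

namespace OpinionMax

/-! Leader-follower DeGroot dynamics on a simple graph. -/

/-- The followers: the nodes that are neither `0`-leaders nor `1`-leaders. -/
abbrev Follower {V : Type*} [DecidableEq V] (S₀ S₁ : Finset V) : Type _ :=
  {v : V // v ∉ S₀ ∪ S₁}

/-- Pairs (follower, `1`-leader), i.e. the elements of `F × S₁`. -/
abbrev Cand {V : Type*} [DecidableEq V] (S₀ S₁ : Finset V) : Type _ :=
  Follower S₀ S₁ × {a : V // a ∈ S₁}

/-- The graph `G(T) = (V, E ∪ T)`. -/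
def addEdges {V : Type*} [DecidableEq V] {S₀ S₁ : Finset V} (G : SimpleGraph V)
    (T : Finset (Cand S₀ S₁)) : SimpleGraph V :=
  G ⊔ SimpleGraph.fromEdgeSet {e | ∃ c ∈ T, e = s(c.1.1, c.2.1)}

open Classical in
/-- Opinion of node `v` at time `t`: `0`-leaders stay at `0`, `1`-leaders stay at `1`, and a follower,
whose opinion at time `0` is `x₀ v`, averages the opinions of its neighbours. -/
def opinion {V : Type*} [Fintype V] [DecidableEq V] (G : SimpleGraph V) (S₀ S₁ : Finset V)
    (x₀ : V → ℝ) : ℕ → V → ℝ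
  | 0, v => if v ∈ S₀ then 0 else if v ∈ S₁ then 1 else x₀ v
  | t + 1, v => if v ∈ S₀ then 0 else if v ∈ S₁ then 1 else
      (∑ w ∈ G.neighborFinset v, opinion G S₀ S₁ x₀ t w) / (G.degree v : ℝ)

/-- The stationary opinion `x_v(∞)`, the limit of the opinions of `v` over time. -/
def stableOpinion {V : Type*} [Fintype V] [DecidableEq V] (G : SimpleGraph V)
    (S₀ S₁ : Finset V) (x₀ : V → ℝ) (v : V) : ℝ :=
  limUnder atTop (fun t : ℕ => opinion G S₀ S₁ x₀ t v)

/-- `H(T)`: the sum of the stationary opinions of all followers in `G(T)`. -/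
def overallOpinion {V : Type*} [Fintype V] [DecidableEq V] (G : SimpleGraph V)
    (S₀ S₁ : Finset V) (x₀ : V → ℝ) (T : Finset (Cand S₀ S₁)) : ℝ :=
  ∑ i : Follower S₀ S₁, stableOpinion (addEdges G T) S₀ S₁ x₀ i.1

/-! Matrices used by the algorithms. -/

open Classical in
/-- The submatrix `L_F` of the graph Laplacian. -/
def lapF {V : Type*} [Fintype V] [DecidableEq V] (G : SimpleGraph V) (S₀ S₁ : Finset V) :
    Matrix (Follower S₀ S₁) (Follower S₀ S₁) ℝ :=
  (G.lapMatrix ℝ).submatrix Subtype.val Subtype.val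

open Classical in
/-- The vector `b`: number of `1`-leaders adjacent to each follower. -/
def bVec {V : Type*} [DecidableEq V] (G : SimpleGraph V) (S₀ S₁ : Finset V) :
    Follower S₀ S₁ → ℝ :=
  fun i => ((S₁.filter (fun a => G.Adj i.1 a)).card : ℝ)

open Classical in
/-- Diagonal of `W`: number of leaders adjacent to each follower. -/
def wVec {V : Type*} [DecidableEq V] (G : SimpleGraph V) (S₀ S₁ : Finset V) :
    Follower S₀ S₁ → ℝ :=
  fun i => (((S₀ ∪ S₁).filter (fun a => G.Adj i.1 a)).card : ℝ)

/-- The subgraph of `G` induced on the followers. -/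
abbrev followerGraph {V : Type*} [DecidableEq V] (G : SimpleGraph V) (S₀ S₁ : Finset V) :
    SimpleGraph (Follower S₀ S₁) :=
  G.comap Subtype.val

/-- The edges of the follower graph, indexing the rows of its incidence matrix. -/
abbrev FEdge {V : Type*} [DecidableEq V] (G : SimpleGraph V) (S₀ S₁ : Finset V) : Type _ :=
  {e : Sym2 (Follower S₀ S₁) // e ∈ (followerGraph G S₀ S₁).edgeSet}

instance {V : Type*} [Fintype V] [DecidableEq V] (G : SimpleGraph V) (S₀ S₁ : Finset V) :
    Fintype (FEdge G S₀ S₁) := Fintype.ofFinite _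

instance {V : Type*} [DecidableEq V] (G : SimpleGraph V) (S₀ S₁ : Finset V) :
    DecidableEq (FEdge G S₀ S₁) := Classical.decEq _

/-- Signed edge-node incidence matrix of the follower graph. The orientation is an arbitrary one:
`Quot.out` picks for every edge an ordered pair (head, tail) of its ends. -/
def incF {V : Type*} [DecidableEq V] (G : SimpleGraph V) (S₀ S₁ : Finset V) :
    Matrix (FEdge G S₀ S₁) (Follower S₀ S₁) ℝ :=
  fun e u => if u = (Quot.out e.1).1 then 1 else if u = (Quot.out e.1).2 then -1 else 0

/-! Randomized linear solvers. -/

/-- `‖x‖_S = √(xᵀ S x)`. -/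
def energyNorm {ι : Type*} [Fintype ι] (S : Matrix ι ι ℝ) (x : ι → ℝ) : ℝ :=
  √(x ⬝ᵥ (S *ᵥ x))

/-- Probability of an event under a discrete distribution. -/
def prob {α : Type*} (μ : PMF α) (s : Set α) : ℝ := (μ.toOuterMeasure s).toReal

/-- A randomized procedure with input a matrix `S`, a vector `y` and an accuracy `δ`. -/
abbrev Solver (ι : Type*) : Type _ := Matrix ι ι ℝ → (ι → ℝ) → ℝ → PMF (ι → ℝ)

/-- On every positive definite system and for every `δ > 0`, a call of the solver returns a vector `x`
with `‖x - S⁻¹ y‖_S ≤ δ ‖S⁻¹ y‖_S`, except with probability at most `p`. -/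
def IsSolver {ι : Type*} [Fintype ι] [DecidableEq ι] (Solve : Solver ι) (p : ℝ) : Prop :=
  ∀ (S : Matrix ι ι ℝ) (y : ι → ℝ) (δ : ℝ), S.PosDef → 0 < δ →
    1 - p ≤ prob (Solve S y δ)
      {x | energyNorm S (x - S⁻¹ *ᵥ y) ≤ δ * energyNorm S (S⁻¹ *ᵥ y)}

/-- Independent calls of the solver on the rows `M 0, …, M (t - 1)`. -/
def solveRows {ι : Type*} (Solve : Solver ι) (S : Matrix ι ι ℝ) (δ : ℝ) :
    (t : ℕ) → (Fin t → ι → ℝ) → PMF (Fin t → ι → ℝ)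
  | 0, _ => PMF.pure Fin.elim0
  | t + 1, M => (Solve S (M 0) δ).bind fun x =>
      (solveRows Solve S δ t (fun j => M j.succ)).bind fun R =>
        PMF.pure (Fin.cons x R)

/-- Random `t × κ` matrix with independent entries, each `1/√t` or `-1/√t` with probability `1/2`. -/
def randomSigns (t : ℕ) (κ : Type*) [Fintype κ] [DecidableEq κ] : PMF (Matrix (Fin t) κ ℝ) :=
  (PMF.uniformOfFintype (Fin t → κ → Bool)).map
    fun σ => Matrix.of fun j c => (if σ j c then 1 else -1) / √(t : ℝ)

/-! The algorithms. -/

/-- `t = ⌈24 log N / (ε/12)²⌉`, where `N` is the number of followers. -/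
def sketchDim (N : ℕ) (ε : ℝ) : ℕ := ⌈24 * Real.log N / (ε / 12) ^ 2⌉₊

def delta1 (n : ℕ) (ε : ℝ) : ℝ := ε / (2 * (n : ℝ) ^ 2 * √(6 * ((n : ℝ) ^ 2 - 1)))

def delta2 (n : ℕ) (ε η : ℝ) : ℝ := (1 - η) * ε / ((n : ℝ) ^ 2 * √(6 * ((n : ℝ) ^ 2 - 1)))

def delta3 (n : ℕ) (ε : ℝ) : ℝ :=
  ε / (72 * (n : ℝ) ^ 2) * √(6 * (1 - ε / 12) / ((1 + ε / 12) * ((n : ℝ) ^ 2 - 1)))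

/-- `OpinionComp(G, R, ε, η)`: the random family of approximate marginal gains of the edges in `R`. -/
def opinionComp {V : Type*} [Fintype V] [DecidableEq V] {S₀ S₁ : Finset V}
    (Solve : Solver (Follower S₀ S₁)) (ε η : ℝ) (G : SimpleGraph V)
    (R : Finset (Cand S₀ S₁)) : PMF ({e : Cand S₀ S₁ // e ∈ R} → ℝ) :=
  let n := Fintype.card V
  let t := sketchDim (Fintype.card (Follower S₀ S₁)) ε
  let L := lapF G S₀ S₁
  (randomSigns t (FEdge G S₀ S₁)).bind fun P =>
  (randomSigns t (Follower S₀ S₁)).bind fun P' =>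
  (Solve L (fun _ => 1) (delta1 n ε)).bind fun h =>
  (Solve L (bVec G S₀ S₁) (delta2 n ε η)).bind fun q =>
  (solveRows Solve L (delta3 n ε) t (P * incF G S₀ S₁)).bind fun X =>
  (solveRows Solve L (delta3 n ε) t
    (P' * Matrix.diagonal fun i => √(wVec G S₀ S₁ i))).bind fun Y =>
  PMF.pure fun e =>
    h e.1.1 * (1 - q e.1.1) / (1 + ∑ j, X j e.1.1 ^ 2 + ∑ j, Y j e.1.1 ^ 2)

/-- A rule (with arbitrary tie-breaking) selecting an element of `R` that maximizes `d`. -/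
def IsArgmaxRule {α : Type*} (sel : (R : Finset α) → ({e : α // e ∈ R} → ℝ) → α) : Prop :=
  ∀ (R : Finset α) (d : {e : α // e ∈ R} → ℝ), R.Nonempty →
    ∃ m : {e : α // e ∈ R}, sel R d = m.1 ∧ ∀ e, d e ≤ d m

/-- `Approx(G, Q, k, ε, η)`: the distribution of the edge set after `k` greedy rounds; each round calls
`OpinionComp` afresh on the current graph and the remaining candidates. -/
def approx {V : Type*} [Fintype V] [DecidableEq V] {S₀ S₁ : Finset V}
    (Solve : Solver (Follower S₀ S₁))
    (sel : (R : Finset (Cand S₀ S₁)) → ({e : Cand S₀ S₁ // e ∈ R} → ℝ) → Cand S₀ S₁)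
    (ε η : ℝ) (G : SimpleGraph V) (Q : Finset (Cand S₀ S₁)) : ℕ → PMF (Finset (Cand S₀ S₁))
  | 0 => PMF.pure ∅
  | k + 1 => (approx Solve sel ε η G Q k).bind fun T =>
      (opinionComp Solve ε η (addEdges G T) (Q \ T)).bind fun d =>
        PMF.pure (insert (sel (Q \ T) d) T)

end OpinionMax

end

open OpinionMax

noncomputable section

namespace OpinionMax

/-! The stationary follower opinions solve `L_F q = b`. Adding `D i` edges from follower `i` to
`1`-leaders changes this to `(M + diagonal D) q = b + D`, with `M` the original `L_F`. Since `M` is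
a Stieltjes matrix, the inverses are entrywise nonnegative and decrease when the diagonal grows.
Hence the gain of a set of edges is an exact sum of terms `h (1 - q)`, with `h` taken after the
addition and `q` before it (`sum_qSol_sub`). A single edge at `i` gains `h_i (1 - q_i) / (1 + r_i)`,
where `r` is the diagonal of the inverse. Both `h_i / (1 + r_i)` and `1 - q_i` decrease as edges are
added, which is the submodularity that greedy selection needs.

The computed gains are inexact in two ways. The coefficient `h_i / (1 + r_i)` has small relative
error: `h` by the solver accuracy, and `r_i` because it is a sum of two squared lengths that random
sign sketches preserve (Johnson-Lindenstrauss). The factor `1 - q_i` has only an additive error,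
proportional to `√r_i`, and it may become tiny during the rounds, so this error cannot be made
relative.

The additive errors are paid for in two ways. On the side of the optimal set, `1 - q ≥ 1 - η` held
before any addition, so their sum is a small multiple of the optimal gain (`totalOpinion_gap_le`).
On the side of the selected edge, `√r_i` is at most `n / 2` the first time follower `i` is used and
at most `1` afterwards, so the errors of all rounds add up to order `n ^ 2` only
(`sqrt_inv_diag_le`, `errorWeight_le`), which the factor `1 / n ^ 2` in the tolerance absorbs.

The usual greedy recursion with these losses is `greedyInvariant_step`, and `greedyInvariant_final`
adds up the error budget. The probability is a union bound over the independent random choices of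
each round (`opinionComp_fail_le`, `approx_fail_le`). Convergence of the dynamics is a contraction
in the sup norm weighted by `L_F⁻¹ 1` (`exists_opinion_sub_le`). -/

/-! Stieltjes matrices: positive definite matrices with nonpositive off-diagonal entries. -/

/-- A real positive definite matrix whose off-diagonal entries are nonpositive. -/
structure IsStieltjes {ι : Type*} [Fintype ι] (M : Matrix ι ι ℝ) : Prop where
  posDef : M.PosDef
  offDiag : ∀ i j, i ≠ j → M i j ≤ 0

/-! ### Positive definite systems: energy form and diagonal of the inverse. -/

section Linear

variable {ι : Type*} [Fintype ι] [DecidableEq ι] {M : Matrix ι ι ℝ}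

lemma posDef_mulVec_inv (hM : M.PosDef) (y : ι → ℝ) : M *ᵥ (M⁻¹ *ᵥ y) = y := by
  rw [mulVec_mulVec, mul_nonsing_inv _ ((isUnit_iff_isUnit_det _).1 hM.isUnit), one_mulVec]

lemma posDef_inv_mulVec (hM : M.PosDef) (y : ι → ℝ) : M⁻¹ *ᵥ (M *ᵥ y) = y := by
  rw [mulVec_mulVec, nonsing_inv_mul _ ((isUnit_iff_isUnit_det _).1 hM.isUnit), one_mulVec]

omit [Fintype ι] [DecidableEq ι] in
lemma posDef_apply_comm (hM : M.PosDef) (i j : ι) : M i j = M j i := by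
  simpa using (hM.isHermitian.apply i j).symm

omit [DecidableEq ι] in
lemma posDef_dotProduct_comm (hM : M.PosDef) (x y : ι → ℝ) :
    x ⬝ᵥ (M *ᵥ y) = y ⬝ᵥ (M *ᵥ x) := by
  simp only [dotProduct, mulVec, Finset.mul_sum]
  rw [Finset.sum_comm]
  refine Finset.sum_congr rfl fun i _ => Finset.sum_congr rfl fun j _ => ?_
  rw [posDef_apply_comm hM j i]; ring

omit [DecidableEq ι] in
lemma posDef_energy_nonneg (hM : M.PosDef) (x : ι → ℝ) : 0 ≤ x ⬝ᵥ (M *ᵥ x) := by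
  simpa using hM.posSemidef.dotProduct_mulVec_nonneg x

omit [DecidableEq ι] in
lemma posDef_energy_pos (hM : M.PosDef) {x : ι → ℝ} (hx : x ≠ 0) : 0 < x ⬝ᵥ (M *ᵥ x) := by
  simpa using hM.dotProduct_mulVec_pos hx

lemma inv_mulVec_single (i j : ι) : (M⁻¹ *ᵥ Pi.single j 1) i = M⁻¹ i j := by
  simp

/-- Cauchy-Schwarz inequality for the energy form, against a column of the inverse. -/
lemma sq_le_inv_diag_mul_energy (hM : M.PosDef) (x : ι → ℝ) (i : ι) :
    x i ^ 2 ≤ M⁻¹ i i * (x ⬝ᵥ (M *ᵥ x)) := by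
  have hr : 0 < M⁻¹ i i := hM.inv.diag_pos
  -- This `s` minimizes the energy of `x - s • M⁻¹ e_i`; nonnegativity of the minimum is the claim.
  set s := x i / M⁻¹ i i
  have h := posDef_energy_nonneg hM (x - s • (M⁻¹ *ᵥ Pi.single i 1))
  have e1 : x ⬝ᵥ (M *ᵥ (M⁻¹ *ᵥ Pi.single i 1)) = x i := by
    rw [posDef_mulVec_inv hM]; simp
  have e2 : (M⁻¹ *ᵥ Pi.single i 1) ⬝ᵥ (M *ᵥ (M⁻¹ *ᵥ Pi.single i 1)) = M⁻¹ i i := by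
    rw [posDef_mulVec_inv hM]; simp
  rw [mulVec_sub, mulVec_smul, sub_dotProduct, dotProduct_sub, dotProduct_sub, smul_dotProduct,
    smul_dotProduct, dotProduct_smul, dotProduct_smul, posDef_dotProduct_comm hM (M⁻¹ *ᵥ Pi.single i 1) x, e1, e2] at h
  simp only [smul_eq_mul] at h
  have hs : s * M⁻¹ i i = x i := div_mul_cancel₀ _ hr.ne'
  have : x i ^ 2 = M⁻¹ i i * (s * x i) := by rw [← hs]; ring
  rw [this]
  refine mul_le_mul_of_nonneg_left ?_ hr.le
  rw [hs] at h; linarith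

lemma abs_le_sqrt_mul_energyNorm (hM : M.PosDef) (x : ι → ℝ) (i : ι) :
    |x i| ≤ √(M⁻¹ i i) * energyNorm M x := by
  rw [energyNorm, ← Real.sqrt_mul hM.inv.diag_pos.le]
  exact Real.abs_le_sqrt (sq_le_inv_diag_mul_energy hM x i)

lemma energy_inv (hM : M.PosDef) (y : ι → ℝ) :
    (M⁻¹ *ᵥ y) ⬝ᵥ (M *ᵥ (M⁻¹ *ᵥ y)) = y ⬝ᵥ (M⁻¹ *ᵥ y) := by
  rw [posDef_mulVec_inv hM, dotProduct_comm]

lemma inv_diag_energy (hM : M.PosDef) (i : ι) :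
    (M⁻¹ *ᵥ Pi.single i 1) ⬝ᵥ (M *ᵥ (M⁻¹ *ᵥ Pi.single i 1)) = M⁻¹ i i := by
  rw [energy_inv hM]; simp

/-- A lower bound of the energy by one coordinate bounds the diagonal of the inverse. -/
lemma inv_diag_le_of_sq_le (hM : M.PosDef) {i : ι} {c : ℝ}
    (h : ∀ x : ι → ℝ, x i ^ 2 ≤ c * (x ⬝ᵥ (M *ᵥ x))) : M⁻¹ i i ≤ c := by
  have hr : 0 < M⁻¹ i i := hM.inv.diag_pos
  -- For the test vector `M⁻¹ e_i`, coordinate `i` and the energy both equal `M⁻¹ i i`.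
  have := h (M⁻¹ *ᵥ Pi.single i 1)
  rw [inv_diag_energy hM, inv_mulVec_single] at this
  nlinarith

lemma one_le_diag_mul_inv_diag (hM : M.PosDef) (i : ι) : 1 ≤ M⁻¹ i i * M i i := by
  have := sq_le_inv_diag_mul_energy hM (Pi.single i 1) i
  simpa using this

omit [Fintype ι] in
lemma add_diagonal_eq (M : Matrix ι ι ℝ) (D D' : ι → ℝ) :
    M + diagonal D' = M + diagonal D + diagonal (D' - D) := by
  rw [add_assoc, diagonal_add]; congr 2; ext i; simp

/-! ### Inverse positivity and comparison of Stieltjes systems. -/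

namespace IsStieltjes

-- Let `y` be the negative part of `x`, so that `x + y` is the positive part. Their supports are
-- disjoint, so only off-diagonal entries contribute to `yᵀ M (x + y)`, which is therefore at most
-- `0`. As `yᵀ M x ≥ 0`, the energy of `y` is at most `0`, and `y` vanishes.
omit [DecidableEq ι] in
lemma nonneg_of_mulVec_nonneg (hM : IsStieltjes M) {x : ι → ℝ} (hx : 0 ≤ M *ᵥ x) : 0 ≤ x := by
  set y : ι → ℝ := fun i => max (-x i) 0
  have hy : ∀ i, 0 ≤ y i := fun i => le_max_right _ _
  have hxy : ∀ i, 0 ≤ (x + y) i := fun i => by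
    have : -x i ≤ y i := le_max_left _ _
    simp only [Pi.add_apply]; linarith
  have hxy0 : ∀ i, y i * (x + y) i = 0 := fun i => by
    simp only [y, Pi.add_apply]
    rcases le_total (-x i) 0 with h | h
    · simp [max_eq_right h]
    · simp [max_eq_left h]
  have h1 : y ⬝ᵥ (M *ᵥ (x + y)) ≤ 0 := by
    simp only [dotProduct, mulVec, Finset.mul_sum]
    refine Finset.sum_nonpos fun i _ => Finset.sum_nonpos fun j _ => ?_
    by_cases hij : i = j
    · subst hij
      have := hxy0 i
      rw [mul_left_comm, this, mul_zero]
    · rw [mul_left_comm]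
      exact mul_nonpos_of_nonpos_of_nonneg (hM.offDiag i j hij) (mul_nonneg (hy i) (hxy j))
  have h2 : 0 ≤ y ⬝ᵥ (M *ᵥ x) := Finset.sum_nonneg fun i _ => mul_nonneg (hy i) (hx i)
  rw [mulVec_add, dotProduct_add] at h1
  have hy0 : y = 0 := by
    by_contra h
    have := posDef_energy_pos hM.posDef h
    linarith
  intro i
  have : -x i ≤ y i := le_max_left _ _
  rw [hy0] at this
  simp only [Pi.zero_apply] at this ⊢
  linarith

lemma inv_mulVec_nonneg (hM : IsStieltjes M) {y : ι → ℝ} (hy : 0 ≤ y) : 0 ≤ M⁻¹ *ᵥ y :=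
  hM.nonneg_of_mulVec_nonneg (by rwa [posDef_mulVec_inv hM.posDef])

lemma inv_nonneg (hM : IsStieltjes M) (i j : ι) : 0 ≤ M⁻¹ i j := by
  have := hM.inv_mulVec_nonneg (y := Pi.single j 1) (by simp) i
  rwa [inv_mulVec_single] at this

lemma inv_diag_pos (hM : IsStieltjes M) (i : ι) : 0 < M⁻¹ i i := hM.posDef.inv.diag_pos

lemma add_diagonal (hM : IsStieltjes M) {d : ι → ℝ} (hd : 0 ≤ d) :
    IsStieltjes (M + diagonal d) where
  posDef := hM.posDef.add_posSemidef (PosSemidef.diagonal hd)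
  offDiag i j hij := by simpa [diagonal_apply_ne _ hij] using hM.offDiag i j hij

/-- Enlarging the diagonal decreases the solutions of systems with nonnegative right-hand sides. -/
lemma inv_mulVec_antitone (hM : IsStieltjes M) {D D' : ι → ℝ} (hD : 0 ≤ D) (hDD' : D ≤ D')
    {y : ι → ℝ} (hy : 0 ≤ y) :
    (M + diagonal D')⁻¹ *ᵥ y ≤ (M + diagonal D)⁻¹ *ᵥ y := by
  have h1 := hM.add_diagonal hD
  have h2 := hM.add_diagonal (hD.trans hDD')
  rw [← sub_nonneg]
  apply h1.nonneg_of_mulVec_nonneg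
  rw [mulVec_sub, posDef_mulVec_inv h1.posDef]
  set x := (M + diagonal D')⁻¹ *ᵥ y with hx
  have hx0 : 0 ≤ x := h2.inv_mulVec_nonneg hy
  -- The solution `x` for the larger diagonal has a nonnegative residual `(D' - D) x` in the system
  -- with the smaller one.
  have : y = (M + diagonal D) *ᵥ x + diagonal (D' - D) *ᵥ x := by
    rw [← add_mulVec, ← add_diagonal_eq, hx, posDef_mulVec_inv h2.posDef]
  rw [this, add_sub_cancel_left]
  intro i
  rw [mulVec_diagonal]
  exact mul_nonneg (sub_nonneg.2 (hDD' i)) (hx0 i)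

lemma inv_diag_le_inv_mulVec_one (hM : IsStieltjes M) (i : ι) :
    M⁻¹ i i ≤ (M⁻¹ *ᵥ fun _ => 1) i := by
  simp only [mulVec, dotProduct, mul_one]
  exact Finset.single_le_sum (fun j _ => hM.inv_nonneg i j) (Finset.mem_univ i)

lemma inv_mulVec_one_pos (hM : IsStieltjes M) (i : ι) : 0 < (M⁻¹ *ᵥ fun _ => 1) i :=
  (hM.inv_diag_pos i).trans_le (hM.inv_diag_le_inv_mulVec_one i)

/-- A diagonal entry increased by at least one makes the diagonal entry of the inverse at most one. -/
lemma inv_diag_le_one (hM : IsStieltjes M) {D : ι → ℝ} (hD : 0 ≤ D) {i : ι} (hi : 1 ≤ D i) :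
    (M + diagonal D)⁻¹ i i ≤ 1 := by
  refine inv_diag_le_of_sq_le (hM.add_diagonal hD).posDef fun x => ?_
  rw [one_mul, add_mulVec, dotProduct_add]
  have h1 := posDef_energy_nonneg hM.posDef x
  have h2 : x i ^ 2 ≤ x ⬝ᵥ (diagonal D *ᵥ x) := by
    simp only [dotProduct, mulVec_diagonal]
    have : x i * (D i * x i) ≤ ∑ j, x j * (D j * x j) :=
      Finset.single_le_sum (f := fun j => x j * (D j * x j))
        (fun j _ => by have := mul_nonneg (hD j) (mul_self_nonneg (x j)); simp at this ⊢; linarith)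
        (Finset.mem_univ i)
    nlinarith [sq_nonneg (x i)]
  linarith

end IsStieltjes

/-! The follower system with `D i` additional edges from follower `i` to `1`-leaders. -/

/-- The solution of `(M + diag D) h = 1`. -/
def hSol (M : Matrix ι ι ℝ) (D : ι → ℝ) : ι → ℝ := (M + diagonal D)⁻¹ *ᵥ fun _ => 1

/-- The solution of `(M + diag D) q = b + D`. -/
def qSol (M : Matrix ι ι ℝ) (b D : ι → ℝ) : ι → ℝ := (M + diagonal D)⁻¹ *ᵥ (b + D)

/-- The gain coefficient `h_i / (1 + r_i)`, where `r` is the diagonal of `(M + diag D)⁻¹`. -/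
def gainCoeff (M : Matrix ι ι ℝ) (D : ι → ℝ) (i : ι) : ℝ :=
  hSol M D i / (1 + (M + diagonal D)⁻¹ i i)

variable {b D D' : ι → ℝ}

lemma hSol_pos (hM : IsStieltjes M) (hD : 0 ≤ D) (i : ι) : 0 < hSol M D i :=
  (hM.add_diagonal hD).inv_mulVec_one_pos i

lemma hSol_antitone (hM : IsStieltjes M) (hD : 0 ≤ D) (h : D ≤ D') : hSol M D' ≤ hSol M D :=
  hM.inv_mulVec_antitone hD h fun _ => zero_le_one

lemma gainCoeff_pos (hM : IsStieltjes M) (hD : 0 ≤ D) (i : ι) : 0 < gainCoeff M D i :=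
  div_pos (hSol_pos hM hD i) (by have := (hM.add_diagonal hD).inv_diag_pos i; linarith)

/-- Apply `M + diagonal D'` to both solutions: the results are `b + D'` and `b + D + (D' - D) q`. -/
lemma qSol_sub (hM : IsStieltjes M) (hD : 0 ≤ D) (h : D ≤ D') :
    qSol M b D' - qSol M b D =
      (M + diagonal D')⁻¹ *ᵥ fun i => (D' i - D i) * (1 - qSol M b D i) := by
  have h1 := hM.add_diagonal hD
  have h2 := hM.add_diagonal (hD.trans h)
  rw [← posDef_inv_mulVec h2.posDef (qSol M b D' - qSol M b D)]
  congr 1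
  rw [mulVec_sub, qSol, posDef_mulVec_inv h2.posDef, add_diagonal_eq M D D', add_mulVec]
  conv_lhs => rw [qSol, posDef_mulVec_inv h1.posDef, ← qSol]
  ext i
  simp only [Pi.sub_apply, Pi.add_apply, mulVec_diagonal]
  ring

/-- Exact change of the total opinion. -/
lemma sum_qSol_sub (hM : IsStieltjes M) (hD : 0 ≤ D) (h : D ≤ D') :
    ∑ i, qSol M b D' i - ∑ i, qSol M b D i =
      ∑ i, hSol M D' i * ((D' i - D i) * (1 - qSol M b D i)) := by
  have h2 := hM.add_diagonal (hD.trans h)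
  have e := qSol_sub (b := b) hM hD h
  rw [← Finset.sum_sub_distrib]
  have : ∑ i, (qSol M b D' i - qSol M b D i) = (fun _ => 1) ⬝ᵥ (qSol M b D' - qSol M b D) := by
    simp [dotProduct]
  -- Symmetry moves the inverse onto the all-ones vector and turns it into `hSol`.
  rw [this, e, posDef_dotProduct_comm h2.posDef.inv, dotProduct]
  exact Finset.sum_congr rfl fun i _ => mul_comm _ _

/-- Maximum principle: `(M + diagonal D) (1 - q) = M 1 - b`, which is nonnegative. -/
lemma one_sub_qSol_nonneg (hM : IsStieltjes M) (hb : b ≤ M *ᵥ fun _ => 1) (hD : 0 ≤ D) (i : ι) :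
    0 ≤ 1 - qSol M b D i := by
  have h1 := hM.add_diagonal hD
  refine h1.nonneg_of_mulVec_nonneg (x := (fun _ => 1) - qSol M b D) ?_ i
  rw [mulVec_sub, qSol, posDef_mulVec_inv h1.posDef, add_mulVec]
  intro j
  have := hb j
  simp only [Pi.sub_apply, Pi.add_apply, mulVec_diagonal, Pi.zero_apply]
  linarith

lemma qSol_mono (hM : IsStieltjes M) (hb : b ≤ M *ᵥ fun _ => 1) (hD : 0 ≤ D) (h : D ≤ D') :
    qSol M b D ≤ qSol M b D' := by
  rw [← sub_nonneg, qSol_sub hM hD h]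
  exact (hM.add_diagonal (hD.trans h)).inv_mulVec_nonneg fun i =>
    mul_nonneg (sub_nonneg.2 (h i)) (one_sub_qSol_nonneg hM hb hD i)

/-- The value of `h` at `i` after adding one edge at `i`. -/
lemma hSol_add_single (hM : IsStieltjes M) (hD : 0 ≤ D) (i : ι) :
    hSol M (D + Pi.single i 1) i = gainCoeff M D i := by
  have h1 := hM.add_diagonal hD
  have hs : (0 : ι → ℝ) ≤ Pi.single i 1 := by simp
  have h2 := hM.add_diagonal (add_nonneg hD hs)
  have hr := h1.inv_diag_pos i
  set h' := hSol M (D + Pi.single i 1) with hh'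
  -- This is the Sherman-Morrison update, written with the new solution on the right; coordinate `i`
  -- then gives `h_i = h'_i (1 + r_i)`.
  have e : hSol M D = h' + h' i • ((M + diagonal D)⁻¹ *ᵥ Pi.single i 1) := by
    rw [← posDef_inv_mulVec h1.posDef (h' + h' i • ((M + diagonal D)⁻¹ *ᵥ Pi.single i 1)), hSol]
    congr 1
    rw [mulVec_add, mulVec_smul, posDef_mulVec_inv h1.posDef]
    have : (fun _ => 1 : ι → ℝ) = (M + diagonal (D + Pi.single i 1)) *ᵥ h' :=
      (posDef_mulVec_inv h2.posDef _).symm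
    rw [this, add_diagonal_eq M D (D + Pi.single i 1), add_mulVec, add_sub_cancel_left]
    congr 1
    ext j
    by_cases hj : j = i
    · subst hj; simp [mulVec_diagonal]
    · simp [mulVec_diagonal, hj]
  have e' := congrFun e i
  simp only [Pi.add_apply, Pi.smul_apply, inv_mulVec_single, smul_eq_mul] at e'
  rw [gainCoeff, eq_div_iff (by linarith), e']; ring

lemma sum_qSol_add_single (hM : IsStieltjes M) (hD : 0 ≤ D) (i : ι) :
    ∑ j, qSol M b (D + Pi.single i 1) j - ∑ j, qSol M b D j =
      gainCoeff M D i * (1 - qSol M b D i) := by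
  have hs : (0 : ι → ℝ) ≤ Pi.single i 1 := by simp
  rw [sum_qSol_sub hM hD (le_add_of_nonneg_right hs), Finset.sum_eq_single i]
  · rw [hSol_add_single hM hD]; simp
  · intro j _ hj; simp [hj]
  · simp

/-- By `hSol_add_single` the coefficient is itself a value of `hSol`, so it inherits the
monotonicity. -/
lemma gainCoeff_antitone (hM : IsStieltjes M) (hD : 0 ≤ D) (h : D ≤ D') (i : ι) :
    gainCoeff M D' i ≤ gainCoeff M D i := by
  have hs : (0 : ι → ℝ) ≤ Pi.single i 1 := by simp
  rw [← hSol_add_single hM hD, ← hSol_add_single hM (hD.trans h)]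
  exact hSol_antitone hM (add_nonneg hD hs) (by gcongr) i

end Linear

/-! Energy of functions on the nodes of a graph. -/

/-- A sum over ordered pairs of adjacent nodes is twice a sum over edges. -/
lemma sum_adj_eq_two_mul_sum_edges {W : Type*} [Fintype W] (G : SimpleGraph W)
    [DecidableRel G.Adj] [Fintype {e : Sym2 W // e ∈ G.edgeSet}] (g : Sym2 W → ℝ) :
    ∑ i, ∑ j, (if G.Adj i j then g s(i, j) else 0) =
      2 * ∑ e : {e : Sym2 W // e ∈ G.edgeSet}, g e.1 := by
  classical
  rw [← Fintype.sum_prod_type' (f := fun i j => if G.Adj i j then g s(i, j) else 0),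
    ← Finset.sum_filter, Finset.mul_sum, ← Finset.sum_subtype G.edgeFinset (by simp)
      (fun e => 2 * g e),
    ← Finset.sum_fiberwise_of_maps_to (g := fun p : W × W => s(p.1, p.2)) (t := G.edgeFinset)
      (by simp)]
  refine Finset.sum_congr rfl fun e he => ?_
  induction e using Sym2.ind with
  | _ a b =>
    have hab : G.Adj a b := by simpa using he
    -- Each edge is hit by exactly its two orientations.
    have : (Finset.univ.filter (fun p : W × W => G.Adj p.1 p.2)).filter
        (fun p => s(p.1, p.2) = s(a, b)) = {(a, b), (b, a)} := by
      ext ⟨u, v⟩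
      simp only [Finset.mem_filter, Finset.mem_univ, true_and, Sym2.eq_iff, Finset.mem_insert,
        Finset.mem_singleton, Prod.mk.injEq]
      constructor
      · exact fun h => h.2
      · rintro (⟨rfl, rfl⟩ | ⟨rfl, rfl⟩)
        · exact ⟨hab, Or.inl ⟨rfl, rfl⟩⟩
        · exact ⟨hab.symm, Or.inr ⟨rfl, rfl⟩⟩
    rw [this, Finset.sum_pair (by simpa using fun h => absurd h hab.ne), Sym2.eq_swap]
    ring

/-- The squared difference of a function along an edge. -/
def edgeSq {W : Type*} (f : W → ℝ) : Sym2 W → ℝ :=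
  Sym2.lift ⟨fun a b => (f a - f b) ^ 2, fun _ _ => by ring⟩

lemma edgeSq_mk {W : Type*} (f : W → ℝ) (a b : W) : edgeSq f s(a, b) = (f a - f b) ^ 2 := rfl

lemma edgeSq_nonneg {W : Type*} (f : W → ℝ) (e : Sym2 W) : 0 ≤ edgeSq f e := by
  induction e using Sym2.ind with
  | _ a b => exact sq_nonneg _

lemma dotProduct_lapMatrix_mulVec {W : Type*} [Fintype W] [DecidableEq W] (G : SimpleGraph W)
    [DecidableRel G.Adj] [Fintype {e : Sym2 W // e ∈ G.edgeSet}] (f : W → ℝ) :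
    f ⬝ᵥ (G.lapMatrix ℝ *ᵥ f) = ∑ e : {e : Sym2 W // e ∈ G.edgeSet}, edgeSq f e.1 := by
  have h := SimpleGraph.lapMatrix_toLinearMap₂' ℝ G f
  rw [Matrix.toLinearMap₂'_apply'] at h
  have h2 := sum_adj_eq_two_mul_sum_edges G (edgeSq f)
  simp only [edgeSq_mk] at h2
  rw [h, h2]; ring

/-- Cauchy-Schwarz for the telescoping sum along the walk, done by induction. -/
lemma sub_sq_le_length_mul_sum_edges {W : Type*} {G : SimpleGraph W} (f : W → ℝ) {u v : W}
    (p : G.Walk u v) : (f u - f v) ^ 2 ≤ p.length * (p.edges.map (edgeSq f)).sum := by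
  induction p with
  | nil => simp
  | @cons u v w h p ih =>
    simp only [SimpleGraph.Walk.length_cons, SimpleGraph.Walk.edges_cons, List.map_cons,
      List.sum_cons, edgeSq_mk]
    set s := (p.edges.map (edgeSq f)).sum
    set l := (p.length : ℝ)
    have hs : 0 ≤ s := List.sum_nonneg (by
      simp only [List.mem_map]; rintro _ ⟨e, _, rfl⟩; exact edgeSq_nonneg f e)
    have hl : 0 ≤ l := Nat.cast_nonneg _
    have : f u - f w = (f u - f v) + (f v - f w) := by ring
    rw [this]
    push_cast
    change _ ≤ (l + 1) * _
    generalize f u - f v = a at *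
    generalize f v - f w = c at *
    rcases hl.eq_or_lt with h0 | h0
    -- An empty remaining walk forces `c = 0`; otherwise one divides by its length.
    · rw [← h0] at ih ⊢
      have : c = 0 := by nlinarith
      subst this; nlinarith
    · have h1 : (a * l - c) ^ 2 ≥ 0 := sq_nonneg _
      have h2 : 2 * a * c * l ≤ a ^ 2 * l ^ 2 + l * s := by nlinarith
      have h3 : l * (2 * a * c) ≤ l * (a ^ 2 * l + s) := by nlinarith
      have h4 := le_of_mul_le_mul_left h3 h0
      nlinarith

/-- Two nodes of a connected graph differ by at most `(n - 1)` times the energy, in square. -/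
lemma sub_sq_le_card_mul_energy {W : Type*} [Fintype W] [DecidableEq W] {G : SimpleGraph W}
    [DecidableRel G.Adj] (hG : G.Connected) (f : W → ℝ) (u v : W) :
    (f u - f v) ^ 2 ≤ ((Fintype.card W : ℝ) - 1) * (f ⬝ᵥ (G.lapMatrix ℝ *ᵥ f)) := by
  classical
  obtain ⟨p, hp⟩ := hG.exists_isPath u v
  have h1 := sub_sq_le_length_mul_sum_edges f p
  have h2 : (p.edges.map (edgeSq f)).sum ≤ f ⬝ᵥ (G.lapMatrix ℝ *ᵥ f) := by
    rw [dotProduct_lapMatrix_mulVec, ← List.sum_toFinset _ hp.isTrail.edges_nodup,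
      ← Finset.sum_subtype G.edgeFinset (by simp) (edgeSq f)]
    refine Finset.sum_le_sum_of_subset_of_nonneg ?_ fun e _ _ => edgeSq_nonneg f e
    intro e he
    simp only [List.mem_toFinset] at he
    simpa using p.edges_subset_edgeSet he
  have h3 : (p.length : ℝ) ≤ (Fintype.card W : ℝ) - 1 := by
    have := hp.length_lt
    have : (p.length : ℝ) + 1 ≤ Fintype.card W := by exact_mod_cast this
    linarith
  refine h1.trans (mul_le_mul h3 h2 ?_ ((Nat.cast_nonneg _).trans h3))
  exact List.sum_nonneg (by
    simp only [List.mem_map]; rintro _ ⟨e, _, rfl⟩; exact edgeSq_nonneg f e)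

/-! The follower submatrix of the Laplacian. -/

section Graph

variable {V : Type*} [Fintype V] [DecidableEq V] {S₀ S₁ : Finset V}

/-- Extension of a function on the followers by zero. -/
def extendZero (x : Follower S₀ S₁ → ℝ) (v : V) : ℝ :=
  if h : v ∉ S₀ ∪ S₁ then x ⟨v, h⟩ else 0

omit [Fintype V] in
lemma extendZero_follower (x : Follower S₀ S₁ → ℝ) (i : Follower S₀ S₁) :
    extendZero x i.1 = x i := by
  simp only [extendZero, dif_pos i.2]

omit [Fintype V] in
lemma extendZero_leader (x : Follower S₀ S₁ → ℝ) {v : V} (hv : v ∈ S₀ ∪ S₁) :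
    extendZero x v = 0 := by
  simp [extendZero, hv]

lemma sum_eq_sum_follower_add (f : V → ℝ) :
    ∑ v, f v = ∑ i : Follower S₀ S₁, f i.1 + ∑ v ∈ S₀ ∪ S₁, f v := by
  rw [← Finset.sum_add_sum_compl (S₀ ∪ S₁) f, add_comm]
  congr 1
  exact Finset.sum_subtype _ (by simp) f

open Classical in
lemma lapF_mulVec (G : SimpleGraph V) (x : Follower S₀ S₁ → ℝ) (i : Follower S₀ S₁) :
    (lapF G S₀ S₁ *ᵥ x) i = (G.lapMatrix ℝ *ᵥ extendZero x) i.1 := by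
  simp only [mulVec, dotProduct]
  rw [sum_eq_sum_follower_add (S₀ := S₀) (S₁ := S₁)]
  have : ∑ v ∈ S₀ ∪ S₁, G.lapMatrix ℝ i.1 v * extendZero x v = 0 :=
    Finset.sum_eq_zero fun v hv => by rw [extendZero_leader x hv, mul_zero]
  rw [this, add_zero]
  simp only [extendZero_follower]
  rfl

open Classical in
lemma lapF_energy (G : SimpleGraph V) (x : Follower S₀ S₁ → ℝ) :
    x ⬝ᵥ (lapF G S₀ S₁ *ᵥ x) = extendZero x ⬝ᵥ (G.lapMatrix ℝ *ᵥ extendZero x) := by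
  simp only [dotProduct]
  rw [sum_eq_sum_follower_add (S₀ := S₀) (S₁ := S₁)]
  have : ∑ v ∈ S₀ ∪ S₁, extendZero x v * (G.lapMatrix ℝ *ᵥ extendZero x) v = 0 :=
    Finset.sum_eq_zero fun v hv => by rw [extendZero_leader x hv, zero_mul]
  rw [this, add_zero]
  simp only [extendZero_follower, lapF_mulVec]

/-- Compare node `i` with a `0`-leader, where the extension by zero vanishes. This makes `L_F`
positive definite and bounds the diagonal of its inverse by `n - 1`. -/
lemma sq_le_card_mul_lapF_energy {G : SimpleGraph V} (hG : G.Connected) (hS₀ : S₀.Nonempty)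
    (x : Follower S₀ S₁ → ℝ) (i : Follower S₀ S₁) :
    x i ^ 2 ≤ ((Fintype.card V : ℝ) - 1) * (x ⬝ᵥ (lapF G S₀ S₁ *ᵥ x)) := by
  classical
  obtain ⟨s, hs⟩ := hS₀
  have := sub_sq_le_card_mul_energy hG (extendZero x) i.1 s
  rw [extendZero_follower, extendZero_leader x (Finset.mem_union_left _ hs), sub_zero] at this
  rw [lapF_energy]
  convert this

lemma lapF_isStieltjes {G : SimpleGraph V} (hG : G.Connected) (hS₀ : S₀.Nonempty) :
    IsStieltjes (lapF G S₀ S₁) := by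
  classical
  have hn : (0 : ℝ) ≤ (Fintype.card V : ℝ) - 1 := by
    have : Nonempty V := ⟨hS₀.choose⟩
    have : (1 : ℝ) ≤ Fintype.card V := by exact_mod_cast Fintype.card_pos
    linarith
  refine ⟨PosDef.of_dotProduct_mulVec_pos ?_ fun x hx => ?_, fun i j hij => ?_⟩
  · refine IsHermitian.submatrix ?_ _
    exact SimpleGraph.isHermitian_lapMatrix ℝ G
  · obtain ⟨i, hi⟩ := Function.ne_iff.1 hx
    have := sq_le_card_mul_lapF_energy hG hS₀ x i
    have h2 : 0 < x i ^ 2 := sq_pos_of_ne_zero (by simpa using hi)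
    simpa using pos_of_mul_pos_right (h2.trans_le this) hn
  · have hij' : i.1 ≠ j.1 := fun h => hij (Subtype.ext h)
    simp only [lapF, submatrix_apply, SimpleGraph.lapMatrix, Matrix.sub_apply, SimpleGraph.degMatrix,
      diagonal_apply_ne _ hij', SimpleGraph.adjMatrix_apply]
    split_ifs <;> norm_num

lemma inv_lapF_diag_le {G : SimpleGraph V} (hG : G.Connected) (hS₀ : S₀.Nonempty)
    (i : Follower S₀ S₁) : (lapF G S₀ S₁)⁻¹ i i ≤ (Fintype.card V : ℝ) - 1 :=
  inv_diag_le_of_sq_le (lapF_isStieltjes hG hS₀).posDef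
    fun x => sq_le_card_mul_lapF_energy hG hS₀ x i

open Classical in
lemma lapF_diag (G : SimpleGraph V) (i : Follower S₀ S₁) : lapF G S₀ S₁ i i = G.degree i.1 := by
  simp [lapF, SimpleGraph.lapMatrix, SimpleGraph.degMatrix]

/-- The sum of the stationary potentials of unit sources at all followers. -/
lemma sum_inv_lapF_one_le {G : SimpleGraph V} (hG : G.Connected) (hS₀ : S₀.Nonempty) :
    ∑ i, ((lapF G S₀ S₁)⁻¹ *ᵥ fun _ => 1) i ≤
      (Fintype.card (Follower S₀ S₁) : ℝ) ^ 2 * ((Fintype.card V : ℝ) - 1) := by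
  have hL := lapF_isStieltjes (S₁ := S₁) hG hS₀
  set h := (lapF G S₀ S₁)⁻¹ *ᵥ fun _ => 1 with hh
  -- The sum `s` is the energy of `h`, so each `h i ^ 2` is at most `(n - 1) s`; Cauchy-Schwarz
  -- gives `s ^ 2 ≤ N ^ 2 (n - 1) s`, and `s` cancels.
  have e : h ⬝ᵥ (lapF G S₀ S₁ *ᵥ h) = ∑ i, h i := by
    rw [hh, posDef_mulVec_inv hL.posDef]; simp [dotProduct]
  have h0 : ∀ i, 0 ≤ h i := fun i => (hL.inv_mulVec_one_pos i).le
  set s := ∑ i, h i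
  have hs : 0 ≤ s := Finset.sum_nonneg fun i _ => h0 i
  have h1 : ∀ i, h i ^ 2 ≤ ((Fintype.card V : ℝ) - 1) * s := fun i => by
    rw [← e]; exact sq_le_card_mul_lapF_energy hG hS₀ h i
  have h2 : s ^ 2 ≤ (Fintype.card (Follower S₀ S₁) : ℝ) * ∑ i, h i ^ 2 := by
    simpa using sq_sum_le_card_mul_sum_sq (s := Finset.univ) (f := h)
  have h3 : ∑ i, h i ^ 2 ≤
      (Fintype.card (Follower S₀ S₁) : ℝ) * (((Fintype.card V : ℝ) - 1) * s) := by
    simpa using Finset.sum_le_card_nsmul Finset.univ (fun i => h i ^ 2) _ fun i _ => h1 i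
  rcases hs.eq_or_lt with h0 | h0
  · rw [← h0]
    have : Nonempty V := ⟨hS₀.choose⟩
    have : (1 : ℝ) ≤ Fintype.card V := by exact_mod_cast Fintype.card_pos
    exact mul_nonneg (sq_nonneg _) (by linarith)
  · have h4 : s ^ 2 ≤ _ := h2.trans (mul_le_mul_of_nonneg_left h3 (Nat.cast_nonneg _))
    have : s * s ≤ s * ((Fintype.card (Follower S₀ S₁) : ℝ) ^ 2 * ((Fintype.card V : ℝ) - 1)) := by
      nlinarith
    exact le_of_mul_le_mul_left this h0

/-- The follower Laplacian is the Laplacian of the follower graph plus the leader degrees. -/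
lemma lapF_eq (G : SimpleGraph V) [DecidableRel (followerGraph G S₀ S₁).Adj] :
    lapF G S₀ S₁ = (followerGraph G S₀ S₁).lapMatrix ℝ + diagonal (wVec G S₀ S₁) := by
  classical
  ext i j
  by_cases hij : i = j
  · subst hij
    rw [lapF_diag, Matrix.add_apply, diagonal_apply_eq]
    simp only [SimpleGraph.lapMatrix, SimpleGraph.degMatrix, Matrix.sub_apply, diagonal_apply_eq,
      SimpleGraph.adjMatrix_apply, SimpleGraph.irrefl, if_false, sub_zero, wVec]
    have h1 := SimpleGraph.degree_eq_sum_if_adj (R := ℝ) (followerGraph G S₀ S₁) i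
    rw [h1, SimpleGraph.degree_eq_sum_if_adj (R := ℝ),
      sum_eq_sum_follower_add (S₀ := S₀) (S₁ := S₁), Finset.card_filter]
    push_cast
    congr 1
    simp only [SimpleGraph.comap_adj]
  · have hij' : i.1 ≠ j.1 := fun h => hij (Subtype.ext h)
    simp only [lapF, submatrix_apply, SimpleGraph.lapMatrix, Matrix.sub_apply, SimpleGraph.degMatrix,
      diagonal_apply_ne _ hij', SimpleGraph.adjMatrix_apply, Matrix.add_apply, diagonal_apply_ne _ hij,
      SimpleGraph.comap_adj, add_zero]

lemma lapF_mulVec_one (G : SimpleGraph V) : lapF G S₀ S₁ *ᵥ (fun _ => 1) = wVec G S₀ S₁ := by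
  classical
  rw [lapF_eq, add_mulVec, SimpleGraph.lapMatrix_mulVec_const_eq_zero, zero_add]
  ext i; simp [mulVec_diagonal]

omit [Fintype V] in
lemma bVec_le_wVec (G : SimpleGraph V) : bVec G S₀ S₁ ≤ wVec G S₀ S₁ := by
  classical
  intro i
  simp only [bVec, wVec, Nat.cast_le]
  exact Finset.card_le_card (Finset.filter_subset_filter _ Finset.subset_union_right)

omit [Fintype V] in
lemma incF_mulVec [Fintype (Follower S₀ S₁)] (G : SimpleGraph V) (x : Follower S₀ S₁ → ℝ)
    (e : FEdge G S₀ S₁) : (incF G S₀ S₁ *ᵥ x) e = x (Quot.out e.1).1 - x (Quot.out e.1).2 := by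
  have hne : (Quot.out e.1).1 ≠ (Quot.out e.1).2 := by
    have h := e.2
    rw [← Quot.out_eq e.1] at h
    exact SimpleGraph.Adj.ne ((SimpleGraph.mem_edgeSet _).1 h)
  simp only [mulVec, dotProduct, incF]
  have : ∀ u, (if u = (Quot.out e.1).1 then 1 else if u = (Quot.out e.1).2 then -1 else 0) * x u =
      (if u = (Quot.out e.1).1 then x u else 0) - (if u = (Quot.out e.1).2 then x u else 0) := by
    intro u
    split_ifs with h1 h2
    · exact absurd (h1.symm.trans h2) hne
    · simp
    · simp
    · simp
  simp only [this, Finset.sum_sub_distrib, Finset.sum_ite_eq', Finset.mem_univ, if_true]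

/-- The factorization `L_F = B̄ᵀ B̄ + W`. At `x = L_F⁻¹ e_i` it splits `r_i` into the two squared
lengths that the algorithm sketches. -/
lemma lapF_energy_eq (G : SimpleGraph V) (x : Follower S₀ S₁ → ℝ) :
    x ⬝ᵥ (lapF G S₀ S₁ *ᵥ x) =
      ∑ e, (incF G S₀ S₁ *ᵥ x) e ^ 2 + ∑ i, (√(wVec G S₀ S₁ i) * x i) ^ 2 := by
  classical
  rw [lapF_eq, add_mulVec, dotProduct_add, dotProduct_lapMatrix_mulVec]
  congr 1
  · refine Finset.sum_congr rfl fun e _ => ?_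
    rw [incF_mulVec, ← edgeSq_mk]
    congr 1
    exact (Quot.out_eq e.1).symm
  · simp only [dotProduct, mulVec_diagonal]
    refine Finset.sum_congr rfl fun i _ => ?_
    rw [mul_pow, Real.sq_sqrt (by simp [wVec])]
    ring

/-! Adding edges between followers and `1`-leaders. -/

/-- The number of pairs of `T` at each follower. -/
def addCount (T : Finset (Cand S₀ S₁)) (i : Follower S₀ S₁) : ℝ :=
  ((T.filter fun c => c.1 = i).card : ℝ)

omit [Fintype V] in
lemma addCount_nonneg (T : Finset (Cand S₀ S₁)) : 0 ≤ addCount T := fun _ => Nat.cast_nonneg _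

omit [Fintype V] in
lemma addCount_mono {T T' : Finset (Cand S₀ S₁)} (h : T ⊆ T') : addCount T ≤ addCount T' :=
  fun _ => Nat.cast_le.2 (Finset.card_le_card (Finset.filter_subset_filter _ h))

omit [Fintype V] in
lemma addCount_empty : addCount (∅ : Finset (Cand S₀ S₁)) = 0 := by
  ext i; simp [addCount]

omit [Fintype V] in
lemma addCount_disjUnion {T T' : Finset (Cand S₀ S₁)} (h : Disjoint T T') :
    addCount (T ∪ T') = addCount T + addCount T' := by
  ext i
  simp only [addCount, Finset.filter_union, Pi.add_apply]
  rw [Finset.card_union_of_disjoint (Finset.disjoint_filter_filter h)]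
  push_cast; rfl

omit [Fintype V] in
lemma addCount_insert {T : Finset (Cand S₀ S₁)} {e : Cand S₀ S₁} (he : e ∉ T) :
    addCount (insert e T) = addCount T + Pi.single e.1 1 := by
  ext i
  simp only [addCount, Finset.filter_insert, Pi.add_apply]
  by_cases h : e.1 = i
  · subst h
    simp [he]
  · simp [h]

lemma sum_mul_addCount (T : Finset (Cand S₀ S₁)) (f : Follower S₀ S₁ → ℝ) :
    ∑ i, f i * addCount T i = ∑ c ∈ T, f c.1 := by
  classical
  rw [← Finset.sum_fiberwise T (fun c => c.1)]
  refine Finset.sum_congr rfl fun i _ => ?_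
  rw [Finset.sum_congr rfl fun c hc => by rw [(Finset.mem_filter.1 hc).2], Finset.sum_const,
    nsmul_eq_mul, addCount, mul_comm]

omit [Fintype V] in
lemma addEdges_adj_leader (G : SimpleGraph V) (T : Finset (Cand S₀ S₁)) (i : Follower S₀ S₁)
    {a : V} (ha : a ∈ S₀ ∪ S₁) :
    (addEdges G T).Adj i.1 a ↔ G.Adj i.1 a ∨ ∃ c ∈ T, c.1 = i ∧ c.2.1 = a := by
  have hne : i.1 ≠ a := fun h => i.2 (h ▸ ha)
  simp only [addEdges, SimpleGraph.sup_adj, SimpleGraph.fromEdgeSet_adj, Set.mem_ofPred_eq]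
  refine or_congr Iff.rfl ⟨?_, ?_⟩
  · rintro ⟨⟨c, hc, h⟩, -⟩
    rcases Sym2.eq_iff.1 h with ⟨h1, h2⟩ | ⟨h1, -⟩
    · exact ⟨c, hc, Subtype.ext h1.symm, h2.symm⟩
    · exact absurd (Finset.mem_union_right S₀ c.2.2) (h1 ▸ i.2)
  · rintro ⟨c, hc, rfl, rfl⟩
    exact ⟨⟨c, hc, rfl⟩, hne⟩

omit [Fintype V] in
lemma followerGraph_addEdges (G : SimpleGraph V) (T : Finset (Cand S₀ S₁)) :
    followerGraph (addEdges G T) S₀ S₁ = followerGraph G S₀ S₁ := by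
  ext i j
  simp only [SimpleGraph.comap_adj, addEdges, SimpleGraph.sup_adj, SimpleGraph.fromEdgeSet_adj,
    Set.mem_ofPred_eq, or_iff_left_iff_imp]
  rintro ⟨⟨c, hc, h⟩, -⟩
  exfalso
  rcases Sym2.eq_iff.1 h with ⟨-, h2⟩ | ⟨h1, -⟩
  · exact j.2 (h2 ▸ Finset.mem_union_right S₀ c.2.2)
  · exact i.2 (h1 ▸ Finset.mem_union_right S₀ c.2.2)

-- Used with `A = S₁` for `b` and with `A = S₀ ∪ S₁` for `W`. Since the pairs of `T` are non-edges,
-- old and new neighbours are disjoint and their numbers add.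
omit [Fintype V] in
open Classical in
lemma card_filter_addEdges (G : SimpleGraph V) {T : Finset (Cand S₀ S₁)}
    (hT : ∀ e ∈ T, ¬ G.Adj e.1.1 e.2.1) (i : Follower S₀ S₁) {A : Finset V} (hA : A ⊆ S₀ ∪ S₁)
    (hA' : S₁ ⊆ A) :
    ((A.filter fun a => (addEdges G T).Adj i.1 a).card : ℝ) =
      (A.filter fun a => G.Adj i.1 a).card + addCount T i := by
  have h1 : A.filter (fun a => (addEdges G T).Adj i.1 a) =
      A.filter (fun a => G.Adj i.1 a) ∪ (T.filter fun c => c.1 = i).image fun c => c.2.1 := by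
    ext a
    simp only [Finset.mem_filter, Finset.mem_union, Finset.mem_image]
    constructor
    · rintro ⟨ha, h⟩
      rcases (addEdges_adj_leader G T i (hA ha)).1 h with h | ⟨c, hc, h1, h2⟩
      · exact Or.inl ⟨ha, h⟩
      · exact Or.inr ⟨c, ⟨hc, h1⟩, h2⟩
    · rintro (⟨ha, h⟩ | ⟨c, ⟨hc, h1⟩, rfl⟩)
      · exact ⟨ha, (addEdges_adj_leader G T i (hA ha)).2 (Or.inl h)⟩
      · have := hA' c.2.2
        exact ⟨this, (addEdges_adj_leader G T i (hA this)).2 (Or.inr ⟨c, hc, h1, rfl⟩)⟩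
  rw [h1, Finset.card_union_of_disjoint, Finset.card_image_of_injOn]
  · push_cast; rfl
  · rintro c hc d hd h
    simp only [Finset.coe_filter, Set.mem_ofPred_eq] at hc hd
    exact Prod.ext (hc.2.trans hd.2.symm) (Subtype.ext h)
  · rw [Finset.disjoint_left]
    rintro a h1 h2
    obtain ⟨c, hc, rfl⟩ := Finset.mem_image.1 h2
    obtain ⟨hc', rfl⟩ := Finset.mem_filter.1 hc
    exact hT c hc' (Finset.mem_filter.1 h1).2

omit [Fintype V] in
lemma bVec_addEdges (G : SimpleGraph V) {T : Finset (Cand S₀ S₁)}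
    (hT : ∀ e ∈ T, ¬ G.Adj e.1.1 e.2.1) :
    bVec (addEdges G T) S₀ S₁ = bVec G S₀ S₁ + addCount T := by
  ext i
  exact card_filter_addEdges G hT i Finset.subset_union_right subset_rfl

omit [Fintype V] in
lemma wVec_addEdges (G : SimpleGraph V) {T : Finset (Cand S₀ S₁)}
    (hT : ∀ e ∈ T, ¬ G.Adj e.1.1 e.2.1) :
    wVec (addEdges G T) S₀ S₁ = wVec G S₀ S₁ + addCount T := by
  ext i
  exact card_filter_addEdges G hT i subset_rfl Finset.subset_union_right

lemma lapF_addEdges (G : SimpleGraph V) {T : Finset (Cand S₀ S₁)}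
    (hT : ∀ e ∈ T, ¬ G.Adj e.1.1 e.2.1) :
    lapF (addEdges G T) S₀ S₁ = lapF G S₀ S₁ + diagonal (addCount T) := by
  classical
  rw [lapF_eq, lapF_eq, wVec_addEdges G hT, add_assoc, diagonal_add]
  -- The two graphs are equal but carry different decidability instances, so a direct rewrite does
  -- not apply.
  have key : ∀ (A B : SimpleGraph (Follower S₀ S₁)) [DecidableRel A.Adj] [DecidableRel B.Adj],
      A = B → A.lapMatrix ℝ = B.lapMatrix ℝ := by
    rintro A B _ _ rfl; congr!
  congr 1
  exact key _ _ (followerGraph_addEdges G T)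

omit [Fintype V] in
lemma addEdges_connected {G : SimpleGraph V} (hG : G.Connected) (T : Finset (Cand S₀ S₁)) :
    (addEdges G T).Connected := hG.mono le_sup_left

end Graph

/-! Convergence of the opinion dynamics. -/

section Dynamics

variable {V : Type*} [Fintype V] [DecidableEq V] {S₀ S₁ : Finset V}

/-- The stationary opinions of the followers, as the solution of a linear system. -/
def followerOpinion (G : SimpleGraph V) (S₀ S₁ : Finset V) : Follower S₀ S₁ → ℝ :=
  (lapF G S₀ S₁)⁻¹ *ᵥ bVec G S₀ S₁

/-- The stationary opinions of all nodes. -/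
def limitOpinion (G : SimpleGraph V) (S₀ S₁ : Finset V) (v : V) : ℝ :=
  extendZero (followerOpinion G S₀ S₁) v + if v ∈ S₁ then 1 else 0

open Classical in
lemma degree_mul_sub_sum_extendZero (G : SimpleGraph V) (x : Follower S₀ S₁ → ℝ)
    (i : Follower S₀ S₁) :
    (G.degree i.1 : ℝ) * x i - ∑ w ∈ G.neighborFinset i.1, extendZero x w =
      (lapF G S₀ S₁ *ᵥ x) i := by
  rw [lapF_mulVec, SimpleGraph.lapMatrix_mulVec_apply, extendZero_follower]

open Classical in
lemma sum_neighbor_limitOpinion {G : SimpleGraph V} (hG : G.Connected) (hS₀ : S₀.Nonempty)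
    (i : Follower S₀ S₁) :
    ∑ w ∈ G.neighborFinset i.1, limitOpinion G S₀ S₁ w =
      (G.degree i.1 : ℝ) * limitOpinion G S₀ S₁ i.1 := by
  have h := degree_mul_sub_sum_extendZero G (followerOpinion G S₀ S₁) i
  rw [followerOpinion, posDef_mulVec_inv (lapF_isStieltjes hG hS₀).posDef, ← followerOpinion] at h
  have hi : i.1 ∉ S₁ := fun h => i.2 (Finset.mem_union_right _ h)
  simp only [limitOpinion, Finset.sum_add_distrib, extendZero_follower, if_neg hi, add_zero]
  have : ∑ w ∈ G.neighborFinset i.1, (if w ∈ S₁ then (1 : ℝ) else 0) = bVec G S₀ S₁ i := by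
    rw [← Finset.sum_filter, Finset.sum_const, nsmul_eq_mul, mul_one, bVec]
    congr 2
    ext w; simp [and_comm]
  rw [this]; linarith

lemma opinion_of_leader (G : SimpleGraph V) (hdisj : Disjoint S₀ S₁) (x₀ : V → ℝ) (t : ℕ) {v : V}
    (hv : v ∈ S₀ ∪ S₁) : opinion G S₀ S₁ x₀ t v = limitOpinion G S₀ S₁ v := by
  have h : opinion G S₀ S₁ x₀ t v = if v ∈ S₀ then 0 else if v ∈ S₁ then 1 else
      opinion G S₀ S₁ x₀ t v := by
    cases t <;> simp only [opinion] <;> split_ifs <;> rfl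
  rw [h, limitOpinion, extendZero_leader _ hv]
  rcases Finset.mem_union.1 hv with h0 | h1
  · rw [if_pos h0, if_neg (Finset.disjoint_left.1 hdisj h0), add_zero]
  · rw [if_neg (Finset.disjoint_right.1 hdisj h1), if_pos h1, if_pos h1, zero_add]

open Classical in
lemma opinion_succ_follower (G : SimpleGraph V) (x₀ : V → ℝ) (t : ℕ) (i : Follower S₀ S₁) :
    opinion G S₀ S₁ x₀ (t + 1) i.1 =
      (∑ w ∈ G.neighborFinset i.1, opinion G S₀ S₁ x₀ t w) / (G.degree i.1 : ℝ) := by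
  have h0 : i.1 ∉ S₀ := fun h => i.2 (Finset.mem_union_left _ h)
  have h1 : i.1 ∉ S₁ := fun h => i.2 (Finset.mem_union_right _ h)
  simp only [opinion, if_neg h0, if_neg h1]

/-- The weight `h = L_F⁻¹ 1`, extended by zero to the leaders, has neighbour sum `d_i h_i - 1` at
follower `i`. One averaging step therefore shrinks an error bounded by a multiple of `h` by a factor
uniformly below `1`; bipartite graphs need no special care. -/
lemma exists_opinion_sub_le {G : SimpleGraph V} (hG : G.Connected) (hdisj : Disjoint S₀ S₁)
    (hS₀ : S₀.Nonempty) [Nonempty (Follower S₀ S₁)] (x₀ : V → ℝ) :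
    ∃ C γ : ℝ, 0 ≤ γ ∧ γ < 1 ∧ ∀ (t : ℕ) (i : Follower S₀ S₁),
      |opinion G S₀ S₁ x₀ t i.1 - limitOpinion G S₀ S₁ i.1| ≤
        C * γ ^ t * ((lapF G S₀ S₁)⁻¹ *ᵥ fun _ => 1) i := by
  classical
  have hL := lapF_isStieltjes (S₁ := S₁) hG hS₀
  set h := (lapF G S₀ S₁)⁻¹ *ᵥ fun _ => 1 with hh
  have hpos : ∀ i, 0 < h i := hL.inv_mulVec_one_pos
  have hV : ∀ v, 0 ≤ extendZero h v := fun v => by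
    rw [extendZero]; split_ifs
    exacts [le_rfl, (hpos _).le]
  have hsum : ∀ i : Follower S₀ S₁, ∑ w ∈ G.neighborFinset i.1, extendZero h w =
      (G.degree i.1 : ℝ) * h i - 1 := fun i => by
    have := degree_mul_sub_sum_extendZero G h i
    rw [hh, posDef_mulVec_inv hL.posDef, ← hh] at this
    linarith
  have hdh : ∀ i : Follower S₀ S₁, 1 ≤ (G.degree i.1 : ℝ) * h i := fun i => by
    have := hsum i
    have h2 : 0 ≤ ∑ w ∈ G.neighborFinset i.1, extendZero h w := Finset.sum_nonneg fun w _ => hV w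
    linarith
  have hd : ∀ i : Follower S₀ S₁, 0 < (G.degree i.1 : ℝ) := fun i =>
    pos_of_mul_pos_left (lt_of_lt_of_le one_pos (hdh i)) (hpos i).le
  -- Any common upper bound of the `d_i h_i` would do; then `d_i h_i - 1 ≤ (1 - 1 / K) d_i h_i`.
  set K := ∑ i : Follower S₀ S₁, (G.degree i.1 : ℝ) * h i
  have hK : ∀ i : Follower S₀ S₁, (G.degree i.1 : ℝ) * h i ≤ K := fun i =>
    Finset.single_le_sum (f := fun i : Follower S₀ S₁ => (G.degree i.1 : ℝ) * h i)
      (fun j _ => zero_le_one.trans (hdh j)) (Finset.mem_univ i)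
  have hK1 : 1 ≤ K := (hdh (Classical.arbitrary _)).trans (hK _)
  set z : ℕ → V → ℝ := fun t v => opinion G S₀ S₁ x₀ t v - limitOpinion G S₀ S₁ v with hz
  have hzl : ∀ t v, v ∈ S₀ ∪ S₁ → z t v = 0 := fun t v hv =>
    sub_eq_zero.2 (opinion_of_leader G hdisj x₀ t hv)
  set C := ∑ i : Follower S₀ S₁, |z 0 i.1| / h i
  have hC : 0 ≤ C := Finset.sum_nonneg fun i _ => div_nonneg (abs_nonneg _) (hpos i).le
  have hγ0 : 0 ≤ 1 - 1 / K := by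
    rw [sub_nonneg, div_le_one (by linarith)]; exact hK1
  refine ⟨C, 1 - 1 / K, hγ0, by have : 0 < 1 / K := by positivity
                                linarith, fun t => ?_⟩
  induction t with
  | zero =>
    intro i
    rw [pow_zero, mul_one, ← div_le_iff₀ (hpos i)]
    exact Finset.single_le_sum (f := fun i : Follower S₀ S₁ => |z 0 i.1| / h i)
      (fun j _ => div_nonneg (abs_nonneg _) (hpos j).le) (Finset.mem_univ i)
  | succ t ih =>
    intro i
    have hCt : 0 ≤ C * (1 - 1 / K) ^ t := mul_nonneg hC (pow_nonneg hγ0 t)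
    have hb : ∀ v, |z t v| ≤ C * (1 - 1 / K) ^ t * extendZero h v := fun v => by
      by_cases hv : v ∈ S₀ ∪ S₁
      · rw [hzl t v hv, abs_zero]; exact mul_nonneg hCt (hV v)
      · have := ih ⟨v, hv⟩
        rwa [← extendZero_follower h] at this
    have e : z (t + 1) i.1 = (∑ w ∈ G.neighborFinset i.1, z t w) / (G.degree i.1 : ℝ) := by
      simp only [hz, opinion_succ_follower, Finset.sum_sub_distrib,
        sum_neighbor_limitOpinion hG hS₀ i]
      field_simp [(hd i).ne']
    change |z (t + 1) i.1| ≤ _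
    rw [e, abs_div, abs_of_pos (hd i), div_le_iff₀ (hd i)]
    calc |∑ w ∈ G.neighborFinset i.1, z t w| ≤ ∑ w ∈ G.neighborFinset i.1, |z t w| :=
          Finset.abs_sum_le_sum_abs _ _
      _ ≤ ∑ w ∈ G.neighborFinset i.1, C * (1 - 1 / K) ^ t * extendZero h w :=
          Finset.sum_le_sum fun w _ => hb w
      _ = C * (1 - 1 / K) ^ t * ((G.degree i.1 : ℝ) * h i - 1) := by
          rw [← Finset.mul_sum, hsum]
      _ ≤ C * (1 - 1 / K) ^ t * ((1 - 1 / K) * ((G.degree i.1 : ℝ) * h i)) := by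
          refine mul_le_mul_of_nonneg_left ?_ hCt
          have : 1 / K * ((G.degree i.1 : ℝ) * h i) ≤ 1 := by
            rw [one_div_mul_eq_div, div_le_one (by linarith)]; exact hK i
          linarith
      _ = C * (1 - 1 / K) ^ (t + 1) * h i * (G.degree i.1 : ℝ) := by ring

lemma tendsto_opinion {G : SimpleGraph V} (hG : G.Connected) (hdisj : Disjoint S₀ S₁)
    (hS₀ : S₀.Nonempty) [Nonempty (Follower S₀ S₁)] (x₀ : V → ℝ) (v : V) :
    Tendsto (fun t : ℕ => opinion G S₀ S₁ x₀ t v) atTop (𝓝 (limitOpinion G S₀ S₁ v)) := by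
  by_cases hv : v ∈ S₀ ∪ S₁
  · simp only [opinion_of_leader G hdisj x₀ _ hv]
    exact tendsto_const_nhds
  · obtain ⟨C, γ, h0, h1, h⟩ := exists_opinion_sub_le hG hdisj hS₀ x₀
    rw [tendsto_iff_dist_tendsto_zero]
    have hlim : Tendsto (fun t : ℕ => C * γ ^ t * ((lapF G S₀ S₁)⁻¹ *ᵥ fun _ => 1) ⟨v, hv⟩) atTop
        (𝓝 0) := by
      have := ((tendsto_pow_atTop_nhds_zero_of_lt_one h0 h1).const_mul C).mul_const
        (((lapF G S₀ S₁)⁻¹ *ᵥ fun _ => 1) ⟨v, hv⟩)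
      simpa using this
    exact squeeze_zero (fun _ => dist_nonneg) (fun t => h t ⟨v, hv⟩) hlim

lemma stableOpinion_follower {G : SimpleGraph V} (hG : G.Connected) (hdisj : Disjoint S₀ S₁)
    (hS₀ : S₀.Nonempty) (x₀ : V → ℝ) (i : Follower S₀ S₁) :
    stableOpinion G S₀ S₁ x₀ i.1 = followerOpinion G S₀ S₁ i := by
  have : Nonempty (Follower S₀ S₁) := ⟨i⟩
  rw [stableOpinion, (tendsto_opinion hG hdisj hS₀ x₀ i.1).limUnder_eq, limitOpinion,
    extendZero_follower, if_neg (fun h => i.2 (Finset.mem_union_right _ h)), add_zero]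

/-- The total opinion in terms of the follower system. -/
lemma overallOpinion_eq {G : SimpleGraph V} (hG : G.Connected) (hdisj : Disjoint S₀ S₁)
    (hS₀ : S₀.Nonempty) (x₀ : V → ℝ) {T : Finset (Cand S₀ S₁)}
    (hT : ∀ e ∈ T, ¬ G.Adj e.1.1 e.2.1) :
    overallOpinion G S₀ S₁ x₀ T =
      ∑ i, qSol (lapF G S₀ S₁) (bVec G S₀ S₁) (addCount T) i := by
  refine Finset.sum_congr rfl fun i _ => ?_
  rw [stableOpinion_follower (addEdges_connected hG T) hdisj hS₀, followerOpinion, qSol,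
    lapF_addEdges G hT, bVec_addEdges G hT]

end Dynamics

/-! Random sign sketches: Johnson-Lindenstrauss estimates. -/

-- Completing the square. Read from right to left, it replaces the exponential of a square by an
-- average of exponentials that are linear in `a`.
open MeasureTheory in
lemma integral_exp_neg_sq_add (a : ℝ) :
    ∫ g : ℝ, Real.exp (-g ^ 2 + 2 * a * g) = √Real.pi * Real.exp (a ^ 2) := by
  have h : ∀ g : ℝ, Real.exp (-g ^ 2 + 2 * a * g) =
      Real.exp (a ^ 2) * Real.exp (-1 * (g - a) ^ 2) := fun g => by
    rw [← Real.exp_add]; congr 1; ring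
  simp only [h]
  rw [integral_const_mul, integral_sub_right_eq_self (fun g : ℝ => Real.exp (-1 * g ^ 2)),
    integral_gaussian, div_one, mul_comm]

open MeasureTheory in
lemma integrable_exp_neg_sq_add (a : ℝ) :
    Integrable fun g : ℝ => Real.exp (-g ^ 2 + 2 * a * g) := by
  have h : ∀ g : ℝ, Real.exp (-g ^ 2 + 2 * a * g) =
      Real.exp (a ^ 2) * Real.exp (-1 * (g - a) ^ 2) := fun g => by
    rw [← Real.exp_add]; congr 1; ring
  simp only [h]
  exact ((integrable_exp_neg_mul_sq one_pos).comp_sub_right a).const_mul _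

section Signs

variable {κ : Type*} [Fintype κ] [DecidableEq κ]

/-- The sign attached to a Boolean. -/
def boolSign (b : Bool) : ℝ := if b then 1 else -1

/-- The signed sum of the entries of a vector. -/
def signSum (v : κ → ℝ) (τ : κ → Bool) : ℝ := ∑ k, boolSign (τ k) * v k

lemma sum_exp_signSum (v : κ → ℝ) (y : ℝ) :
    ∑ τ : κ → Bool, Real.exp (y * signSum v τ) = 2 ^ Fintype.card κ * ∏ k, Real.cosh (y * v k) := by
  have h : ∀ τ : κ → Bool, Real.exp (y * signSum v τ) =
      ∏ k, Real.exp (y * (boolSign (τ k) * v k)) := fun τ => by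
    rw [← Real.exp_sum, signSum, Finset.mul_sum]
  simp only [h]
  have h2 := Finset.prod_univ_sum (fun _ : κ => (Finset.univ : Finset Bool))
    (fun k b => Real.exp (y * (boolSign b * v k)))
  rw [Fintype.piFinset_univ] at h2
  rw [← h2]
  have h3 : ∀ k, ∑ b : Bool, Real.exp (y * (boolSign b * v k)) = 2 * Real.cosh (y * v k) :=
    fun k => by
      rw [Fintype.sum_bool, Real.cosh_eq]
      simp [boolSign]
      ring
  simp only [h3, Finset.prod_mul_distrib, Finset.prod_const, Finset.card_univ]

lemma sum_exp_signSum_le (v : κ → ℝ) (y : ℝ) :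
    ∑ τ : κ → Bool, Real.exp (y * signSum v τ) ≤
      2 ^ Fintype.card κ * Real.exp (y ^ 2 / 2 * ∑ k, v k ^ 2) := by
  rw [sum_exp_signSum, Finset.mul_sum, Real.exp_sum]
  refine mul_le_mul_of_nonneg_left ?_ (by positivity)
  refine Finset.prod_le_prod (fun k _ => (Real.cosh_pos _).le) fun k _ => ?_
  refine (Real.cosh_le_exp_half_sq _).trans (le_of_eq ?_)
  congr 1; ring

open MeasureTheory in
/-- Exponential moment of the square of a signed sum, by comparison with a Gaussian. -/
lemma sum_exp_sq_signSum_le (v : κ → ℝ) {l : ℝ} (hl : 0 ≤ l) (h1 : 2 * (l * ∑ k, v k ^ 2) < 1) :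
    ∑ τ : κ → Bool, Real.exp (l * signSum v τ ^ 2) ≤
      2 ^ Fintype.card κ * (√(1 - 2 * (l * ∑ k, v k ^ 2)))⁻¹ := by
  set s := ∑ k, v k ^ 2
  set m := l * s with hm
  have hpi : 0 < √Real.pi := Real.sqrt_pos.2 Real.pi_pos
  -- Linearize the square with an auxiliary Gaussian variable `g`; after exchanging sum and
  -- integral, the sum over signs is bounded for each fixed `g`.
  have e1 : ∀ τ : κ → Bool, √Real.pi * Real.exp (l * signSum v τ ^ 2) =
      ∫ g : ℝ, Real.exp (-g ^ 2 + 2 * (√l * signSum v τ) * g) := fun τ => by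
    rw [integral_exp_neg_sq_add, mul_pow, Real.sq_sqrt hl]
  have e2 : √Real.pi * ∑ τ : κ → Bool, Real.exp (l * signSum v τ ^ 2) =
      ∫ g : ℝ, ∑ τ : κ → Bool, Real.exp (-g ^ 2 + 2 * (√l * signSum v τ) * g) := by
    rw [integral_finsetSum _ fun τ _ => integrable_exp_neg_sq_add _, Finset.mul_sum]
    exact Finset.sum_congr rfl fun τ _ => e1 τ
  have e3 : ∫ g : ℝ, ∑ τ : κ → Bool, Real.exp (-g ^ 2 + 2 * (√l * signSum v τ) * g) ≤
      ∫ g : ℝ, 2 ^ Fintype.card κ * Real.exp (-(1 - 2 * m) * g ^ 2) := by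
    refine integral_mono (integrable_finsetSum _ fun τ _ => integrable_exp_neg_sq_add _)
      ((integrable_exp_neg_mul_sq (by linarith)).const_mul _) fun g => ?_
    have := sum_exp_signSum_le v (2 * √l * g)
    have h2 := mul_le_mul_of_nonneg_left this (Real.exp_pos (-g ^ 2)).le
    rw [Finset.mul_sum] at h2
    refine (le_of_eq ?_).trans (h2.trans (le_of_eq ?_))
    · refine Finset.sum_congr rfl fun τ _ => ?_
      rw [← Real.exp_add]; congr 1; ring
    · rw [mul_left_comm, ← Real.exp_add]
      congr 2
      rw [mul_pow, mul_pow, Real.sq_sqrt hl, hm]; ring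
  rw [← e2, integral_const_mul, integral_gaussian, Real.sqrt_div Real.pi_pos.le] at e3
  refine le_of_mul_le_mul_left (e3.trans (le_of_eq ?_)) hpi
  rw [div_eq_mul_inv]; ring

lemma sum_sq_signSum (v : κ → ℝ) :
    ∑ τ : κ → Bool, signSum v τ ^ 2 = 2 ^ Fintype.card κ * ∑ k, v k ^ 2 := by
  have h : ∀ k l : κ, ∑ τ : κ → Bool, boolSign (τ k) * boolSign (τ l) =
      if k = l then 2 ^ Fintype.card κ else 0 := by
    intro k l
    split_ifs with hkl
    · subst hkl
      have : ∀ b : Bool, boolSign b * boolSign b = 1 := by intro b; cases b <;> simp [boolSign]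
      simp [this]
    -- Flipping the sign at `k` negates the product of two distinct signs, so its sum is zero.
    · have hinv : Function.Involutive fun τ : κ → Bool => Function.update τ k (!τ k) :=
        fun τ => by simp
      let φ : Equiv.Perm (κ → Bool) := hinv.toPerm
      have := Equiv.sum_comp φ (fun τ : κ → Bool => boolSign (τ k) * boolSign (τ l))
      have h2 : ∀ τ : κ → Bool, boolSign (φ τ k) * boolSign (φ τ l) =
          -(boolSign (τ k) * boolSign (τ l)) := fun τ => by
        have hb : ∀ b : Bool, boolSign (!b) = -boolSign b := by
          intro b; cases b <;> simp [boolSign]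
        simp [φ, Function.Involutive.toPerm, Function.update_of_ne (Ne.symm hkl), hb]
      simp only [h2, Finset.sum_neg_distrib] at this
      linarith
  have h2 : ∀ τ : κ → Bool, signSum v τ ^ 2 =
      ∑ k, ∑ l, v k * v l * (boolSign (τ k) * boolSign (τ l)) := fun τ => by
    rw [sq, signSum, Finset.sum_mul_sum]
    exact Finset.sum_congr rfl fun k _ => Finset.sum_congr rfl fun l _ => by ring
  simp only [h2]
  rw [Finset.sum_comm, Finset.mul_sum]
  refine Finset.sum_congr rfl fun k _ => ?_
  rw [Finset.sum_comm]
  simp only [← Finset.mul_sum, h, mul_ite, mul_zero, Finset.sum_ite_eq, Finset.mem_univ, if_true]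
  ring

/-- The Taylor series begins `1 + m + 3/2 m ^ 2`; the slack between `3/2` and `8/5` covers the
higher terms on this range. -/
lemma inv_sqrt_one_sub_le {m : ℝ} (h0 : 0 ≤ m) (h1 : m ≤ 1 / 36) :
    (√(1 - 2 * m))⁻¹ ≤ 1 + m + 8 / 5 * m ^ 2 := by
  have hp : 0 < 1 - 2 * m := by linarith
  rw [inv_le_iff_one_le_mul₀ (Real.sqrt_pos.2 hp)]
  have h2 : 0 ≤ 1 + m + 8 / 5 * m ^ 2 := by positivity
  rw [← Real.sqrt_sq h2, ← Real.sqrt_mul (sq_nonneg _)]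
  refine Real.le_sqrt_of_sq_le ?_
  have h3 : 0 ≤ m ^ 2 * (1 / 36 - m) := mul_nonneg (sq_nonneg _) (by linarith)
  have h4 : 0 ≤ m ^ 3 * (1 / 36 - m) := mul_nonneg (by positivity) (by linarith)
  have h5 : 0 ≤ m ^ 4 * (1 / 36 - m) := mul_nonneg (by positivity) (by linarith)
  have h6 : 0 ≤ m ^ 4 := by positivity
  nlinarith [sq_nonneg m]

lemma sum_exp_sq_signSum_upper (v : κ → ℝ) {l : ℝ} (hl : 0 ≤ l)
    (h1 : l * ∑ k, v k ^ 2 ≤ 1 / 36) :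
    ∑ τ : κ → Bool, Real.exp (l * signSum v τ ^ 2) ≤ 2 ^ Fintype.card κ *
      Real.exp (l * ∑ k, v k ^ 2 + 3 / 2 * (l * ∑ k, v k ^ 2) ^ 2) := by
  refine (sum_exp_sq_signSum_le v hl (by linarith)).trans ?_
  set m := l * ∑ k, v k ^ 2
  have h0 : 0 ≤ m := mul_nonneg hl (Finset.sum_nonneg fun k _ => sq_nonneg _)
  refine mul_le_mul_of_nonneg_left ((inv_sqrt_one_sub_le h0 h1).trans ?_) (by positivity)
  have h2 : 0 ≤ m + 3 / 2 * m ^ 2 := by positivity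
  have h3 : 0 ≤ m ^ 3 := by positivity
  have h4 : 0 ≤ m ^ 4 := by positivity
  refine le_trans ?_ (Real.quadratic_le_exp_of_nonneg h2)
  nlinarith [sq_nonneg m]

lemma sum_exp_sq_signSum_lower (v : κ → ℝ) {l : ℝ} (hl : 0 ≤ l)
    (h1 : l * ∑ k, v k ^ 2 ≤ 1 / 36) :
    ∑ τ : κ → Bool, Real.exp (-(l * signSum v τ ^ 2)) ≤ 2 ^ Fintype.card κ *
      Real.exp (-(l * ∑ k, v k ^ 2) + 3 / 2 * (l * ∑ k, v k ^ 2) ^ 2) := by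
  -- The inequality `y ≤ sinh y` reduces the negative exponential moment to the positive one and the
  -- exact second moment of the signed sum.
  have e : ∀ y : ℝ, 0 ≤ y → Real.exp (-y) ≤ Real.exp y - 2 * y := fun y hy => by
    have := Real.self_le_sinh_iff.2 hy
    rw [Real.sinh_eq] at this; linarith
  have h2 : ∑ τ : κ → Bool, Real.exp (-(l * signSum v τ ^ 2)) ≤
      ∑ τ : κ → Bool, (Real.exp (l * signSum v τ ^ 2) - 2 * (l * signSum v τ ^ 2)) :=
    Finset.sum_le_sum fun τ _ => e _ (mul_nonneg hl (sq_nonneg _))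
  rw [Finset.sum_sub_distrib, ← Finset.mul_sum, ← Finset.mul_sum, sum_sq_signSum] at h2
  have h3 := sum_exp_sq_signSum_le v hl (by linarith)
  refine h2.trans ?_
  have e2 : 2 * (l * (2 ^ Fintype.card κ * ∑ k, v k ^ 2)) =
    2 ^ Fintype.card κ * (2 * (l * ∑ k, v k ^ 2)) := by ring
  rw [e2]
  set m := l * ∑ k, v k ^ 2
  have h0 : 0 ≤ m := mul_nonneg hl (Finset.sum_nonneg fun k _ => sq_nonneg _)
  have h4 := inv_sqrt_one_sub_le h0 h1
  have h5 : 1 - m + 8 / 5 * m ^ 2 ≤ Real.exp (-m + 3 / 2 * m ^ 2) := by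
    -- The bound `1 + x ≤ exp x` misses the coefficient `8/5`; applying it to `x / 2` and squaring
    -- gains the term `x ^ 2 / 4`.
    have h6 : 1 + (-m + 3 / 2 * m ^ 2) / 2 ≤ Real.exp ((-m + 3 / 2 * m ^ 2) / 2) := by
      have := Real.add_one_le_exp ((-m + 3 / 2 * m ^ 2) / 2); linarith
    have h7 : 0 ≤ 1 + (-m + 3 / 2 * m ^ 2) / 2 := by nlinarith [sq_nonneg m]
    have h8 : Real.exp (-m + 3 / 2 * m ^ 2) = Real.exp ((-m + 3 / 2 * m ^ 2) / 2) ^ 2 := by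
      rw [← Real.exp_nat_mul]; congr 1; push_cast; ring
    rw [h8]
    refine le_trans ?_ (pow_le_pow_left₀ h7 h6 2)
    have h3 : 0 ≤ m ^ 2 * (1 / 36 - m) := mul_nonneg (sq_nonneg _) (by linarith)
    have h9 : 0 ≤ m ^ 4 := by positivity
    nlinarith [sq_nonneg m]
  have hp : (0 : ℝ) < 2 ^ Fintype.card κ := by positivity
  have h10 : (√(1 - 2 * m))⁻¹ - 2 * m ≤ Real.exp (-m + 3 / 2 * m ^ 2) := by linarith
  calc _ ≤ 2 ^ Fintype.card κ * (√(1 - 2 * m))⁻¹ - 2 ^ Fintype.card κ * (2 * m) := by linarith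
    _ = 2 ^ Fintype.card κ * ((√(1 - 2 * m))⁻¹ - 2 * m) := by ring
    _ ≤ _ := mul_le_mul_of_nonneg_left h10 hp.le

/-- Chernoff's inequality for independent, uniformly distributed rows. -/
lemma card_rows_mul_exp_le {t : ℕ} (f : (κ → Bool) → ℝ) (A : Finset (Fin t → κ → Bool)) {c B : ℝ}
    (hA : ∀ σ ∈ A, c ≤ ∑ j, f (σ j)) (hB : ∑ τ, Real.exp (f τ) ≤ B) :
    (A.card : ℝ) * Real.exp c ≤ B ^ t := by
  classical
  have h2 := Finset.prod_univ_sum (fun _ : Fin t => (Finset.univ : Finset (κ → Bool)))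
    (fun _ τ => Real.exp (f τ))
  rw [Fintype.piFinset_univ, Finset.prod_const, Finset.card_univ, Fintype.card_fin] at h2
  calc (A.card : ℝ) * Real.exp c = ∑ σ ∈ A, Real.exp c := by rw [Finset.sum_const, nsmul_eq_mul]
    _ ≤ ∑ σ ∈ A, ∏ j : Fin t, Real.exp (f (σ j)) := Finset.sum_le_sum fun σ hσ => by
        rw [← Real.exp_sum]; exact Real.exp_le_exp.2 (hA σ hσ)
    _ ≤ ∑ σ : Fin t → κ → Bool, ∏ j : Fin t, Real.exp (f (σ j)) :=
        Finset.sum_le_sum_of_subset_of_nonneg (Finset.subset_univ _) fun σ _ _ =>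
          Finset.prod_nonneg fun j _ => (Real.exp_pos _).le
    _ = (∑ τ, Real.exp (f τ)) ^ t := h2.symm
    _ ≤ B ^ t := pow_le_pow_left₀ (Finset.sum_nonneg fun τ _ => (Real.exp_pos _).le) hB t

open Classical in
/-- The fraction of sign matrices that distort the squared length of a vector. -/
lemma card_signSum_distort_le {t : ℕ} (v : κ → ℝ) (hv : 0 < ∑ k, v k ^ 2) {δ : ℝ}
    (h0 : 0 ≤ δ) (h1 : δ ≤ 1 / 12) :
    ((Finset.univ.filter fun σ : Fin t → κ → Bool =>
      ¬ |∑ j, signSum v (σ j) ^ 2 - t * ∑ k, v k ^ 2| ≤ δ * (t * ∑ k, v k ^ 2)).card : ℝ) ≤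
      2 * Real.exp (-(t * δ ^ 2 / 6)) * (2 ^ Fintype.card κ) ^ t := by
  set s := ∑ k, v k ^ 2
  -- Chernoff parameter: with `l s = δ / 3` both tails have exponent `δ ^ 2 / 6 - δ ^ 2 / 3 = -δ ^ 2
  -- / 6` per row.
  set l := δ / 3 / s
  have hl : 0 ≤ l := by positivity
  have hls : l * s = δ / 3 := div_mul_cancel₀ _ hv.ne'
  set U := Finset.univ.filter fun σ : Fin t → κ → Bool =>
    (1 + δ) * (t * s) ≤ ∑ j, signSum v (σ j) ^ 2
  set L := Finset.univ.filter fun σ : Fin t → κ → Bool =>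
    ∑ j, signSum v (σ j) ^ 2 ≤ (1 - δ) * (t * s)
  have hU := card_rows_mul_exp_le (fun τ => l * signSum v τ ^ 2) U
    (c := t * (δ / 3 * (1 + δ)))
    (fun σ hσ => by
      rw [← Finset.mul_sum]
      have := mul_le_mul_of_nonneg_left (Finset.mem_filter.1 hσ).2 hl
      refine le_trans (le_of_eq ?_) this
      rw [← hls]; ring)
    (sum_exp_sq_signSum_upper v hl (by rw [hls]; linarith))
  have hL := card_rows_mul_exp_le (fun τ => -(l * signSum v τ ^ 2)) L
    (c := -(t * (δ / 3 * (1 - δ))))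
    (fun σ hσ => by
      rw [Finset.sum_neg_distrib, ← Finset.mul_sum, neg_le_neg_iff]
      have := mul_le_mul_of_nonneg_left (Finset.mem_filter.1 hσ).2 hl
      refine this.trans (le_of_eq ?_)
      rw [← hls]; ring)
    (sum_exp_sq_signSum_lower v hl (by rw [hls]; linarith))
  change _ ≤ (_ * Real.exp (l * s + 3 / 2 * (l * s) ^ 2)) ^ t at hU
  change _ ≤ (_ * Real.exp (-(l * s) + 3 / 2 * (l * s) ^ 2)) ^ t at hL
  rw [hls, mul_pow, ← Real.exp_nat_mul, ← le_div_iff₀ (Real.exp_pos _), mul_div_assoc,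
    ← Real.exp_sub] at hU hL
  have eU : (t : ℝ) * (δ / 3 + 3 / 2 * (δ / 3) ^ 2) - t * (δ / 3 * (1 + δ)) = -(t * δ ^ 2 / 6) := by
    ring
  have eL : (t : ℝ) * (-(δ / 3) + 3 / 2 * (δ / 3) ^ 2) - -(t * (δ / 3 * (1 - δ))) =
      -(t * δ ^ 2 / 6) := by ring
  rw [eU] at hU
  rw [eL] at hL
  have hsub : (Finset.univ.filter fun σ : Fin t → κ → Bool =>
      ¬ |∑ j, signSum v (σ j) ^ 2 - t * s| ≤ δ * (t * s)) ⊆ U ∪ L := by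
    intro σ hσ
    have h := (Finset.mem_filter.1 hσ).2
    rw [abs_le, not_and_or, not_le, not_le] at h
    simp only [Finset.mem_union, U, L, Finset.mem_filter, Finset.mem_univ, true_and]
    rcases h with h | h
    · right; linarith
    · left; linarith
  have hcard : ((U ∪ L).card : ℝ) ≤ U.card + L.card := by exact_mod_cast Finset.card_union_le U L
  have := (Nat.cast_le (α := ℝ)).2 (Finset.card_le_card hsub)
  linarith

omit [DecidableEq κ] in
/-- The sketch of a vector by a matrix of random signs. -/
lemma sum_sq_signs_mulVec {t : ℕ} (v : κ → ℝ) (σ : Fin t → κ → Bool) :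
    ∑ j, ((Matrix.of fun j c => (if σ j c then (1 : ℝ) else -1) / √(t : ℝ)) *ᵥ v) j ^ 2 =
      (∑ j, signSum v (σ j) ^ 2) / t := by
  rw [Finset.sum_div]
  refine Finset.sum_congr rfl fun j _ => ?_
  have : ((Matrix.of fun j c => (if σ j c then (1 : ℝ) else -1) / √(t : ℝ)) *ᵥ v) j =
      signSum v (σ j) / √(t : ℝ) := by
    simp only [mulVec, dotProduct, of_apply, signSum, boolSign, Finset.sum_div]
    exact Finset.sum_congr rfl fun k _ => by ring
  rw [this, div_pow, Real.sq_sqrt (Nat.cast_nonneg _)]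

/-- A vector whose squared length is not preserved up to a factor `1 ± δ` by the sketch `P`. -/
def Distorts {t : ℕ} (P : Matrix (Fin t) κ ℝ) (δ : ℝ) (v : κ → ℝ) : Prop :=
  ¬ |∑ j, (P *ᵥ v) j ^ 2 - ∑ k, v k ^ 2| ≤ δ * ∑ k, v k ^ 2

lemma randomSigns_distorts_le {t : ℕ} (ht : 0 < t) (v : κ → ℝ) {δ : ℝ}
    (h0 : 0 ≤ δ) (h1 : δ ≤ 1 / 12) :
    (randomSigns t κ).toOuterMeasure {P | Distorts P δ v} ≤
      ENNReal.ofReal (2 * Real.exp (-(t * δ ^ 2 / 6))) := by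
  classical
  have ht' : (0 : ℝ) < t := Nat.cast_pos.2 ht
  rcases (Finset.sum_nonneg fun k (_ : k ∈ Finset.univ) => sq_nonneg (v k)).eq_or_lt with hv | hv
  · have hv0 : v = 0 := by
      ext k
      have := (Finset.sum_eq_zero_iff_of_nonneg fun k _ => sq_nonneg (v k)).1 hv.symm k
        (Finset.mem_univ k)
      simpa using this
    have : {P : Matrix (Fin t) κ ℝ | Distorts P δ v} = ∅ := by
      ext P; simp [Distorts, hv0]
    rw [this]; simp
  · rw [randomSigns, PMF.toOuterMeasure_map_apply, PMF.toOuterMeasure_uniformOfFintype_apply]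
    have hcard : (Fintype.card (Fin t → κ → Bool) : ℝ) = (2 ^ Fintype.card κ) ^ t := by
      simp
    have hpos : (0 : ℝ) < Fintype.card (Fin t → κ → Bool) := by rw [hcard]; positivity
    have h := card_signSum_distort_le (t := t) v hv h0 h1
    rw [← hcard] at h
    rw [ENNReal.div_le_iff (by simp) (by simp),
      ← ENNReal.ofReal_natCast (Fintype.card (Fin t → κ → Bool)), ← ENNReal.ofReal_mul (by positivity),
      ← ENNReal.ofReal_natCast]
    refine ENNReal.ofReal_le_ofReal (le_trans (le_of_eq ?_) h)
    rw [Fintype.card_subtype]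
    congr 2
    ext σ
    simp only [Finset.mem_filter, Finset.mem_univ, true_and, Set.mem_preimage, Set.mem_ofPred_eq,
      Distorts, sum_sq_signs_mulVec]
    rw [not_iff_not, ← mul_le_mul_iff_right₀ ht', ← abs_of_pos ht', ← abs_mul, abs_of_pos ht', mul_sub,
      mul_div_cancel₀ _ ht'.ne', mul_left_comm]

/-- Johnson-Lindenstrauss estimate for a family of vectors. -/
lemma randomSigns_exists_distorts_le {ι : Type*} [Fintype ι] [Nonempty ι] (v : ι → κ → ℝ) {δ : ℝ}
    (h0 : 0 < δ) (h1 : δ ≤ 1 / 12) {t : ℕ} (ht : 24 * Real.log (Fintype.card ι) / δ ^ 2 ≤ t) :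
    (randomSigns t κ).toOuterMeasure {P | ∃ i, Distorts P δ (v i)} ≤
      ENNReal.ofReal (2 / (Fintype.card ι : ℝ) ^ 3) := by
  set N := Fintype.card ι
  have hN : (1 : ℝ) ≤ N := by exact_mod_cast Fintype.card_pos
  have ht2 : 24 * Real.log N ≤ t * δ ^ 2 := by rwa [div_le_iff₀ (by positivity)] at ht
  rcases Nat.eq_zero_or_pos t with h | h
  -- Zero rows are possible only for `N = 1`, where the claimed bound `2` is trivial.
  · have : Real.log N ≤ 0 := by rw [h] at ht2; simp at ht2; linarith
    have hN1 : (N : ℝ) = 1 := by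
      by_contra hne
      exact absurd this (not_le.2 (Real.log_pos (lt_of_le_of_ne hN (Ne.symm hne))))
    rw [hN1]
    refine le_trans ?_ (ENNReal.ofReal_le_ofReal (p := 1) (by norm_num))
    rw [ENNReal.ofReal_one]
    exact (PMF.toOuterMeasure_apply _ _).trans_le
      ((ENNReal.tsum_le_tsum fun a => Set.indicator_le_self _ _ a).trans (PMF.tsum_coe _).le)
  · have hset : {P : Matrix (Fin t) κ ℝ | ∃ i, Distorts P δ (v i)} =
        ⋃ i ∈ (Finset.univ : Finset ι), {P | Distorts P δ (v i)} := by
      ext P; simp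
    rw [hset]
    refine (MeasureTheory.measure_biUnion_finset_le _ _).trans ?_
    refine (Finset.sum_le_sum fun i _ => randomSigns_distorts_le h (v i) h0.le h1).trans ?_
    rw [Finset.sum_const, Finset.card_univ, nsmul_eq_mul, ← ENNReal.ofReal_natCast,
      ← ENNReal.ofReal_mul (Nat.cast_nonneg _)]
    refine ENNReal.ofReal_le_ofReal ?_
    change (N : ℝ) * _ ≤ _
    -- The constant `24` gives `N ^ (-4)` per vector, which leaves `N ^ (-3)` after the union over
    -- `N` vectors.
    have hexp : Real.exp (-(t * δ ^ 2 / 6)) ≤ 1 / (N : ℝ) ^ 4 := by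
      have : 1 / (N : ℝ) ^ 4 = Real.exp (-(4 * Real.log N)) := by
        rw [Real.exp_neg, one_div]
        congr 1
        rw [show (4 : ℝ) * Real.log N = ((4 : ℕ) : ℝ) * Real.log N by norm_num, Real.exp_nat_mul,
          Real.exp_log (by linarith)]
      rw [this]
      exact Real.exp_le_exp.2 (by linarith)
    calc (N : ℝ) * (2 * Real.exp (-(t * δ ^ 2 / 6))) ≤ N * (2 * (1 / (N : ℝ) ^ 4)) := by gcongr
      _ = 2 / (N : ℝ) ^ 3 := by field_simp

end Signs

/-! Probabilities of bad events. -/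

lemma toOuterMeasure_add_compl {α : Type*} (μ : PMF α) (s : Set α) :
    μ.toOuterMeasure s + μ.toOuterMeasure sᶜ = 1 := by
  rw [PMF.toOuterMeasure_apply, PMF.toOuterMeasure_apply, ← ENNReal.tsum_add, ← μ.tsum_coe]
  exact tsum_congr fun a => congrFun (Set.indicator_self_add_compl s (⇑μ)) a

lemma toOuterMeasure_le_one {α : Type*} (μ : PMF α) (s : Set α) : μ.toOuterMeasure s ≤ 1 :=
  le_self_add.trans (toOuterMeasure_add_compl μ s).le

lemma toOuterMeasure_compl_le {α : Type*} {μ : PMF α} {s : Set α} {p : ℝ} (h : 1 - p ≤ prob μ s) :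
    μ.toOuterMeasure sᶜ ≤ ENNReal.ofReal p := by
  have h1 : μ.toOuterMeasure s ≠ ⊤ := ne_top_of_le_ne_top ENNReal.one_ne_top (toOuterMeasure_le_one μ s)
  have h2 : μ.toOuterMeasure sᶜ ≠ ⊤ :=
    ne_top_of_le_ne_top ENNReal.one_ne_top (toOuterMeasure_le_one μ _)
  have h3 := congrArg ENNReal.toReal (toOuterMeasure_add_compl μ s)
  rw [ENNReal.toReal_add h1 h2, ENNReal.toReal_one] at h3
  rw [prob] at h
  exact ENNReal.le_ofReal_iff_toReal_le h2 (ENNReal.toReal_nonneg.trans (by linarith)) |>.2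
    (by linarith)

lemma le_prob_of_compl_le {α : Type*} {μ : PMF α} {s : Set α} {p : ℝ} (hp : 0 ≤ p)
    (h : μ.toOuterMeasure sᶜ ≤ ENNReal.ofReal p) : 1 - p ≤ prob μ s := by
  have h1 : μ.toOuterMeasure s ≠ ⊤ := ne_top_of_le_ne_top ENNReal.one_ne_top (toOuterMeasure_le_one μ s)
  have h2 : μ.toOuterMeasure sᶜ ≠ ⊤ :=
    ne_top_of_le_ne_top ENNReal.one_ne_top (toOuterMeasure_le_one μ _)
  have h3 := congrArg ENNReal.toReal (toOuterMeasure_add_compl μ s)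
  rw [ENNReal.toReal_add h1 h2, ENNReal.toReal_one] at h3
  have h4 := ENNReal.toReal_le_of_le_ofReal hp h
  rw [prob]; linarith

/-- Union bound for two successive random choices. -/
lemma toOuterMeasure_bind_le {α β : Type*} {μ : PMF α} {f : α → PMF β} {A : Set α} {B : Set β}
    {a b : ENNReal} (hA : μ.toOuterMeasure A ≤ a)
    (hB : ∀ x ∈ μ.support, x ∉ A → (f x).toOuterMeasure B ≤ b) :
    (μ.bind f).toOuterMeasure B ≤ a + b := by
  rw [PMF.toOuterMeasure_bind_apply]
  calc ∑' x, μ x * (f x).toOuterMeasure B ≤ ∑' x, (A.indicator μ x + μ x * b) := by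
        refine ENNReal.tsum_le_tsum fun x => ?_
        by_cases hx : x ∈ A
        · rw [Set.indicator_of_mem hx]
          exact (mul_le_of_le_one_right' (toOuterMeasure_le_one _ _)).trans le_self_add
        · by_cases h0 : μ x = 0
          · simp [h0]
          · exact (mul_le_mul_right (hB x h0 hx) _).trans le_add_self
    _ = μ.toOuterMeasure A + b := by
        rw [ENNReal.tsum_add, ENNReal.tsum_mul_right, μ.tsum_coe, one_mul,
          PMF.toOuterMeasure_apply]
    _ ≤ a + b := by gcongr

lemma toOuterMeasure_pure_le {α : Type*} {x : α} {B : Set α} (h : x ∉ B) (b : ENNReal) :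
    (PMF.pure x).toOuterMeasure B ≤ b := by
  rw [PMF.toOuterMeasure_pure_apply, if_neg h]; exact zero_le

/-! ### Failure probability of solver calls. -/

section Solver

variable {ι : Type*} [Fintype ι] [DecidableEq ι] {Solve : Solver ι} {p : ℝ} {S : Matrix ι ι ℝ}

/-- The vector `x` solves `S x = y` up to relative error `δ` in the energy norm. -/
def IsApproxSol (S : Matrix ι ι ℝ) (y : ι → ℝ) (δ : ℝ) (x : ι → ℝ) : Prop :=
  energyNorm S (x - S⁻¹ *ᵥ y) ≤ δ * energyNorm S (S⁻¹ *ᵥ y)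

lemma solve_fail_le (hSolve : IsSolver Solve p) (hS : S.PosDef) (y : ι → ℝ) {δ : ℝ} (hδ : 0 < δ) :
    (Solve S y δ).toOuterMeasure {x | ¬ IsApproxSol S y δ x} ≤ ENNReal.ofReal p :=
  toOuterMeasure_compl_le (hSolve S y δ hS hδ)

lemma solveRows_fail_le (hSolve : IsSolver Solve p) (hS : S.PosDef) {δ : ℝ} (hδ : 0 < δ)
    (t : ℕ) (M : Fin t → ι → ℝ) :
    (solveRows Solve S δ t M).toOuterMeasure {X | ¬ ∀ j, IsApproxSol S (M j) δ (X j)} ≤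
      t * ENNReal.ofReal p := by
  induction t with
  | zero => exact toOuterMeasure_pure_le (by simp) _
  | succ t ih =>
    rw [solveRows]
    have : ((t + 1 : ℕ) : ENNReal) * ENNReal.ofReal p =
        ENNReal.ofReal p + (t * ENNReal.ofReal p + 0) := by
      push_cast; rw [add_mul, one_mul, add_zero, add_comm]
    rw [this]
    refine toOuterMeasure_bind_le (solve_fail_le hSolve hS (M 0) hδ) fun x _ hx => ?_
    refine toOuterMeasure_bind_le (ih fun j => M j.succ) fun X _ hX => ?_
    refine toOuterMeasure_pure_le ?_ _
    simp only [Set.mem_ofPred_eq, not_not] at hx hX ⊢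
    intro j
    refine Fin.cases ?_ (fun j => ?_) j
    · simpa using hx
    · simpa using hX j

end Solver

/-! Accuracy of the sketched systems. -/

section Sketch

variable {ι κ : Type*} [Fintype ι] [DecidableEq ι] [Fintype κ] [DecidableEq κ]

/-- Every entry squares to `1 / t`, so the bound holds for each outcome and costs no probability.
Equality fails only for `t = 0` with `κ` nonempty. -/
lemma sum_sq_le_of_mem_support {t : ℕ} {P : Matrix (Fin t) κ ℝ}
    (hP : P ∈ (randomSigns t κ).support) : ∑ j, ∑ k, P j k ^ 2 ≤ Fintype.card κ := by
  rw [randomSigns, PMF.support_map] at hP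
  obtain ⟨σ, -, rfl⟩ := hP
  have : ∀ j k, ((Matrix.of fun j c => (if σ j c then (1 : ℝ) else -1) / √(t : ℝ)) j k) ^ 2 =
      1 / t := fun j k => by
    rw [of_apply, div_pow, Real.sq_sqrt (Nat.cast_nonneg _)]
    split_ifs <;> norm_num
  simp only [this, Finset.sum_const, Finset.card_univ, Fintype.card_fin, nsmul_eq_mul]
  rcases Nat.eq_zero_or_pos t with h | h
  · subst h; simp
  · have : (t : ℝ) ≠ 0 := by positivity
    exact le_of_eq (by field_simp)

omit [DecidableEq ι] [DecidableEq κ] in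
lemma mul_row_dotProduct {t : ℕ} (P : Matrix (Fin t) κ ℝ) (K : Matrix κ ι ℝ) (j : Fin t)
    (z : ι → ℝ) : (P * K) j ⬝ᵥ z = ∑ k, P j k * (K *ᵥ z) k := by
  have : (P * K) j ⬝ᵥ z = ((P * K) *ᵥ z) j := rfl
  rw [this, ← mulVec_mulVec]; rfl

-- The energy `E` of `z` equals the inner product of row `P j` with `K z`, and `|K z| ^ 2 ≤ E`;
-- Cauchy-Schwarz gives `E ^ 2 ≤ |P j| ^ 2 E`.
omit [DecidableEq κ] in
lemma energy_sketch_row_le {L : Matrix ι ι ℝ} (hL : L.PosDef) {K : Matrix κ ι ℝ}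
    (hK : ∀ x, ∑ k, (K *ᵥ x) k ^ 2 ≤ x ⬝ᵥ (L *ᵥ x)) {t : ℕ} (P : Matrix (Fin t) κ ℝ) (j : Fin t) :
    energyNorm L (L⁻¹ *ᵥ (P * K) j) ^ 2 ≤ ∑ k, P j k ^ 2 := by
  set z := L⁻¹ *ᵥ (P * K) j with hz
  have h0 := posDef_energy_nonneg hL z
  rw [energyNorm, Real.sq_sqrt h0]
  set E := z ⬝ᵥ (L *ᵥ z) with hE
  have h1 : E = ∑ k, P j k * (K *ᵥ z) k := by
    rw [hE, hz, energy_inv hL, ← hz, mul_row_dotProduct]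
  have h2 : E ^ 2 ≤ (∑ k, P j k ^ 2) * ∑ k, (K *ᵥ z) k ^ 2 := by
    conv_lhs => rw [h1]
    exact Finset.sum_mul_sq_le_sq_mul_sq _ _ _
  have h3 : 0 ≤ ∑ k, P j k ^ 2 := Finset.sum_nonneg fun k _ => sq_nonneg _
  have h4 : E * E ≤ (∑ k, P j k ^ 2) * E := by
    rw [← sq]; exact h2.trans (mul_le_mul_of_nonneg_left (hK z) h3)
  rcases h0.eq_or_lt with h | h
  · rw [← h]; exact h3
  · exact le_of_mul_le_mul_right h4 h

omit [DecidableEq κ] in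
/-- The columns of an approximately solved sketch have nearly the right length. -/
lemma sketch_column_error {L : Matrix ι ι ℝ} (hL : L.PosDef) {K : Matrix κ ι ℝ}
    (hK : ∀ x, ∑ k, (K *ᵥ x) k ^ 2 ≤ x ⬝ᵥ (L *ᵥ x)) {t : ℕ} {P : Matrix (Fin t) κ ℝ}
    {m δ ε : ℝ} (hP : ∑ j, ∑ k, P j k ^ 2 ≤ m) (hε : 0 < ε) (hε1 : ε < 1 / 2)
    (hδm : δ ^ 2 * m ≤ (ε / 200) ^ 2)
    {X : Fin t → ι → ℝ} (hX : ∀ j, IsApproxSol L ((P * K) j) δ (X j)) (i : ι)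
    (hJL : ¬ Distorts P (ε / 12) (K *ᵥ (L⁻¹ *ᵥ Pi.single i 1))) :
    |∑ j, X j i ^ 2 - ∑ k, (K *ᵥ (L⁻¹ *ᵥ Pi.single i 1)) k ^ 2| ≤
      ε / 12 * ∑ k, (K *ᵥ (L⁻¹ *ᵥ Pi.single i 1)) k ^ 2 + ε / 96 * L⁻¹ i i := by
  set v := K *ᵥ (L⁻¹ *ᵥ Pi.single i 1)
  set s := ∑ k, v k ^ 2
  set r := L⁻¹ i i with hr
  have hr0 : 0 < r := hL.inv.diag_pos
  have hs0 : 0 ≤ s := Finset.sum_nonneg fun k _ => sq_nonneg _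
  have hsr : s ≤ r := (hK _).trans (inv_diag_energy hL i).le
  -- By symmetry of `L⁻¹`, the exact sketch entry `a j` is coordinate `i` of the exact solution of
  -- row system `j`; `y` below is the solver error.
  set a : Fin t → ℝ := fun j => (P *ᵥ v) j
  have ha : ∀ j, a j = (L⁻¹ *ᵥ (P * K) j) i := fun j => by
    have h1 := posDef_dotProduct_comm hL.inv (Pi.single i 1) ((P * K) j)
    rw [single_dotProduct, one_mul, mul_row_dotProduct] at h1
    rw [h1]; rfl
  set y : Fin t → ℝ := fun j => X j i - a j
  have hy : ∀ j, y j ^ 2 ≤ r * (δ ^ 2 * ∑ k, P j k ^ 2) := fun j => by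
    have h1 := abs_le_sqrt_mul_energyNorm hL (X j - L⁻¹ *ᵥ (P * K) j) i
    have h2 : |y j| ≤ √r * (δ * energyNorm L (L⁻¹ *ᵥ (P * K) j)) := by
      simp only [y, ha]
      exact h1.trans (mul_le_mul_of_nonneg_left (hX j) (Real.sqrt_nonneg _))
    have h3 := pow_le_pow_left₀ (abs_nonneg _) h2 2
    rw [sq_abs, mul_pow, mul_pow, Real.sq_sqrt hr0.le] at h3
    refine h3.trans ?_
    gcongr
    exact energy_sketch_row_le hL hK P j
  have hy2 : ∑ j, y j ^ 2 ≤ r * (ε / 200) ^ 2 := by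
    calc ∑ j, y j ^ 2 ≤ ∑ j, r * (δ ^ 2 * ∑ k, P j k ^ 2) := Finset.sum_le_sum fun j _ => hy j
      _ = r * (δ ^ 2 * ∑ j, ∑ k, P j k ^ 2) := by rw [Finset.mul_sum, Finset.mul_sum]
      _ ≤ r * (δ ^ 2 * m) := by gcongr
      _ ≤ _ := by gcongr
  have hJL' : |∑ j, a j ^ 2 - s| ≤ ε / 12 * s := not_not.1 hJL
  have ha2 : ∑ j, a j ^ 2 ≤ 25 / 24 * r := by
    have := (abs_le.1 hJL').2
    nlinarith
  -- Arithmetic-geometric mean with weight `ε / 200`, matched to the bound `r (ε / 200) ^ 2` on the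
  -- solver errors.
  have hc : |∑ j, 2 * (a j * y j)| ≤ ε / 200 * ∑ j, a j ^ 2 + 200 / ε * ∑ j, y j ^ 2 := by
    refine (Finset.abs_sum_le_sum_abs _ _).trans ?_
    rw [Finset.mul_sum, Finset.mul_sum, ← Finset.sum_add_distrib]
    refine Finset.sum_le_sum fun j _ => ?_
    have e1 : 0 ≤ 200 / ε * (ε / 200 * a j - y j) ^ 2 := by positivity
    have e2 : 0 ≤ 200 / ε * (ε / 200 * a j + y j) ^ 2 := by positivity
    have e3 : 200 / ε * (ε / 200 * a j - y j) ^ 2 =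
        ε / 200 * a j ^ 2 + 200 / ε * y j ^ 2 - 2 * (a j * y j) := by field_simp; ring
    have e4 : 200 / ε * (ε / 200 * a j + y j) ^ 2 =
        ε / 200 * a j ^ 2 + 200 / ε * y j ^ 2 + 2 * (a j * y j) := by field_simp; ring
    exact abs_le.2 ⟨by linarith, by linarith⟩
  have hy3 : 200 / ε * ∑ j, y j ^ 2 ≤ ε / 200 * r := by
    calc 200 / ε * ∑ j, y j ^ 2 ≤ 200 / ε * (r * (ε / 200) ^ 2) := by gcongr
      _ = ε / 200 * r := by field_simp
  have hy4 : r * (ε / 200) ^ 2 ≤ ε / 80000 * r := by nlinarith [mul_pos hε hr0]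
  have hsum : ∑ j, X j i ^ 2 = ∑ j, a j ^ 2 + ∑ j, 2 * (a j * y j) + ∑ j, y j ^ 2 := by
    rw [← Finset.sum_add_distrib, ← Finset.sum_add_distrib]
    exact Finset.sum_congr rfl fun j _ => by simp only [y]; ring
  have hy0 : 0 ≤ ∑ j, y j ^ 2 := Finset.sum_nonneg fun j _ => sq_nonneg _
  have ha3 : ε / 200 * ∑ j, a j ^ 2 ≤ ε / 200 * (25 / 24 * r) := by gcongr
  have hfin : ε / 200 * (25 / 24 * r) + ε / 200 * r + ε / 80000 * r ≤ ε / 96 * r := by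
    nlinarith [mul_pos hε hr0]
  rw [hsum]
  rw [abs_le] at hJL' hc ⊢
  constructor <;> linarith [hJL'.1, hJL'.2, hc.1, hc.2]

end Sketch

/-! Accuracy of `opinionComp`. -/

section Comp

variable {V : Type*} [Fintype V] [DecidableEq V] {S₀ S₁ : Finset V}

lemma card_follower_add (hdisj : Disjoint S₀ S₁) :
    (Fintype.card V : ℝ) = Fintype.card (Follower S₀ S₁) + (S₀.card + S₁.card) := by
  have h := sum_eq_sum_follower_add (S₀ := S₀) (S₁ := S₁) (fun _ : V => (1 : ℝ))
  simp only [Finset.sum_const, Finset.card_univ, nsmul_eq_mul, mul_one] at h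
  rw [h, Finset.card_union_of_disjoint hdisj]
  push_cast; rfl

lemma card_follower_le (hdisj : Disjoint S₀ S₁) (hS₀ : S₀.Nonempty) (hS₁ : S₁.Nonempty) :
    (Fintype.card (Follower S₀ S₁) : ℝ) ≤ Fintype.card V - 2 := by
  have h := card_follower_add hdisj
  have h0 : (1 : ℝ) ≤ S₀.card := by exact_mod_cast hS₀.card_pos
  have h1 : (1 : ℝ) ≤ S₁.card := by exact_mod_cast hS₁.card_pos
  linarith

lemma three_le_card (hdisj : Disjoint S₀ S₁) (hS₀ : S₀.Nonempty) (hS₁ : S₁.Nonempty)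
    [Nonempty (Follower S₀ S₁)] : (3 : ℝ) ≤ Fintype.card V := by
  have h := card_follower_le hdisj hS₀ hS₁
  have : (1 : ℝ) ≤ Fintype.card (Follower S₀ S₁) := by exact_mod_cast Fintype.card_pos
  linarith

lemma card_follower_mul_le (hdisj : Disjoint S₀ S₁) (hS₀ : S₀.Nonempty) :
    (Fintype.card (Follower S₀ S₁) : ℝ) * S₁.card ≤ ((Fintype.card V : ℝ) - 1) ^ 2 / 4 := by
  have h := card_follower_add hdisj
  have h0 : (1 : ℝ) ≤ S₀.card := by exact_mod_cast hS₀.card_pos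
  have h2 : (Fintype.card (Follower S₀ S₁) : ℝ) + S₁.card ≤ (Fintype.card V : ℝ) - 1 := by linarith
  have hN : (0 : ℝ) ≤ Fintype.card (Follower S₀ S₁) := Nat.cast_nonneg _
  have hS : (0 : ℝ) ≤ S₁.card := Nat.cast_nonneg _
  nlinarith [sq_nonneg ((Fintype.card (Follower S₀ S₁) : ℝ) - S₁.card),
    pow_le_pow_left₀ (add_nonneg hN hS) h2 2]

/-! ### Numerical bounds for the three solver tolerances. -/

lemma two_mul_le_sqrt {n : ℝ} (hn : 1 ≤ n) : 2 * (n - 1) ≤ √(6 * (n ^ 2 - 1)) :=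
  Real.le_sqrt_of_sq_le (by nlinarith)

lemma delta1_pos {n : ℕ} (hn : (3 : ℝ) ≤ n) {ε : ℝ} (hε : 0 < ε) : 0 < delta1 n ε := by
  have : 0 < √(6 * ((n : ℝ) ^ 2 - 1)) := Real.sqrt_pos.2 (by nlinarith)
  unfold delta1; positivity

lemma delta1_mul_le {n : ℕ} (hn : (3 : ℝ) ≤ n) {ε N : ℝ} (hε : 0 < ε)
    (hN : N ≤ n - 2) : delta1 n ε * (N * (n - 1)) ≤ ε / 32 := by
  have h1 := two_mul_le_sqrt (n := n) (by linarith)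
  have h2 : 0 < √(6 * ((n : ℝ) ^ 2 - 1)) := Real.sqrt_pos.2 (by nlinarith)
  rw [delta1, div_mul_eq_mul_div, div_le_div_iff₀ (by positivity) (by norm_num)]
  set q := √(6 * ((n : ℝ) ^ 2 - 1))
  -- From `N ≤ n - 2` and `(n - 4) ^ 2 ≥ 0`.
  have h3 : 8 * N ≤ (n : ℝ) ^ 2 := by nlinarith [sq_nonneg ((n : ℝ) - 4)]
  have h4 : 8 * N * (2 * ((n : ℝ) - 1)) ≤ (n : ℝ) ^ 2 * q :=
    mul_le_mul h3 h1 (by linarith) (by positivity)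
  calc ε * (N * (n - 1)) * 32 = 2 * ε * (8 * N * (2 * ((n : ℝ) - 1))) := by ring
    _ ≤ 2 * ε * ((n : ℝ) ^ 2 * q) := by gcongr
    _ = _ := by ring

lemma delta2_pos {n : ℕ} (hn : (3 : ℝ) ≤ n) {ε η : ℝ} (hε : 0 < ε) (hη : η < 1) :
    0 < delta2 n ε η := by
  have : 0 < √(6 * ((n : ℝ) ^ 2 - 1)) := Real.sqrt_pos.2 (by nlinarith)
  have h2 : 0 < 1 - η := by linarith
  unfold delta2; positivity

/-- The additive error of the opinions, per square root of the resistance. -/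
def opinionErr (n : ℕ) (ε η : ℝ) : ℝ := (1 - η) * ε / (4 * (n : ℝ) ^ 2)

lemma delta2_mul_le {n : ℕ} (hn : (3 : ℝ) ≤ n) {ε η : ℝ} (hε : 0 < ε) (hη : η < 1) :
    delta2 n ε η * (((n : ℝ) - 1) / 2) ≤ opinionErr n ε η := by
  have h1 := two_mul_le_sqrt (n := n) (by linarith)
  have h2 : 0 < √(6 * ((n : ℝ) ^ 2 - 1)) := Real.sqrt_pos.2 (by nlinarith)
  have h3 : 0 < 1 - η := by linarith
  rw [delta2, opinionErr, div_mul_eq_mul_div, div_le_div_iff₀ (by positivity) (by positivity)]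
  set q := √(6 * ((n : ℝ) ^ 2 - 1))
  calc (1 - η) * ε * ((n - 1) / 2) * (4 * (n : ℝ) ^ 2) =
        (1 - η) * ε * (n : ℝ) ^ 2 * (2 * ((n : ℝ) - 1)) := by ring
    _ ≤ (1 - η) * ε * (n : ℝ) ^ 2 * q := by gcongr
    _ = _ := by ring

lemma delta3_pos {n : ℕ} (hn : (3 : ℝ) ≤ n) {ε : ℝ} (hε : 0 < ε) (hε1 : ε < 1 / 2) :
    0 < delta3 n ε := by
  have h1 : 0 < (n : ℝ) ^ 2 - 1 := by nlinarith
  have h2 : 0 < 1 - ε / 12 := by linarith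
  unfold delta3
  exact mul_pos (by positivity) (Real.sqrt_pos.2 (by positivity))

lemma delta3_sq_mul_le {n : ℕ} (hn : (3 : ℝ) ≤ n) {ε m : ℝ} (hε : 0 < ε) (hε1 : ε < 1 / 2)
    (hm : m ≤ (n : ℝ) ^ 2) : delta3 n ε ^ 2 * m ≤ (ε / 200) ^ 2 := by
  have h1 : 8 ≤ (n : ℝ) ^ 2 - 1 := by nlinarith
  have h2 : 0 < 1 - ε / 12 := by linarith
  have h3 : 6 * (1 - ε / 12) / ((1 + ε / 12) * ((n : ℝ) ^ 2 - 1)) ≤ 3 / 4 := by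
    rw [div_le_div_iff₀ (by positivity) (by norm_num)]
    nlinarith
  have h4 : (0 : ℝ) < n := by linarith
  have h5 : (9 : ℝ) ≤ (n : ℝ) ^ 2 := by linarith
  have hpos : 0 ≤ 6 * (1 - ε / 12) / ((1 + ε / 12) * ((n : ℝ) ^ 2 - 1)) := by positivity
  rw [delta3, mul_pow, Real.sq_sqrt hpos]
  calc (ε / (72 * (n : ℝ) ^ 2)) ^ 2 * (6 * (1 - ε / 12) / ((1 + ε / 12) * ((n : ℝ) ^ 2 - 1))) * m
      ≤ (ε / (72 * (n : ℝ) ^ 2)) ^ 2 * (6 * (1 - ε / 12) / ((1 + ε / 12) * ((n : ℝ) ^ 2 - 1))) *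
          (n : ℝ) ^ 2 := by gcongr
    _ ≤ (ε / (72 * (n : ℝ) ^ 2)) ^ 2 * (3 / 4) * (n : ℝ) ^ 2 := by gcongr
    _ = ε ^ 2 * (3 / 4) / (5184 * (n : ℝ) ^ 2) := by field_simp; ring
    _ ≤ ε ^ 2 * (3 / 4) / (5184 * 9) := by gcongr
    _ ≤ (ε / 200) ^ 2 := by nlinarith [sq_nonneg ε]

/-- Here `g = h_i`, `r = r_i`, and `s` is the squared energy norm of `h`. The lower bound `1 ≤ g (n
- 1)` supplies a second factor `g`, so the energy-norm error becomes an error relative to `h_i`. -/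
lemma sqrt_mul_sqrt_le {r g n N s : ℝ} (hr : 0 ≤ r) (hrg : r ≤ g) (hn : 1 ≤ n) (hN : 0 ≤ N)
    (h1 : 1 ≤ g * (n - 1)) (hs0 : 0 ≤ s) (hs : s ≤ N ^ 2 * (n - 1)) :
    √r * √s ≤ g * (N * (n - 1)) := by
  have hn1 : 0 ≤ n - 1 := by linarith
  have hg : 0 ≤ g := hr.trans hrg
  rw [← Real.sqrt_mul hr]
  refine Real.sqrt_le_iff.2 ⟨by positivity, ?_⟩
  calc r * s ≤ g * (N ^ 2 * (n - 1)) := mul_le_mul hrg hs hs0 hg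
    _ ≤ g * (N ^ 2 * (n - 1)) * (g * (n - 1)) := le_mul_of_one_le_right (by positivity) h1
    _ = (g * (N * (n - 1))) ^ 2 := by ring

/-- The chain is `h_i ≥ r_i ≥ 1 / d_i ≥ 1 / (n - 1)`. -/
lemma one_le_inv_lapF_mul {G : SimpleGraph V} (hG : G.Connected) (hS₀ : S₀.Nonempty)
    (i : Follower S₀ S₁) :
    1 ≤ ((lapF G S₀ S₁)⁻¹ *ᵥ fun _ => 1) i * ((Fintype.card V : ℝ) - 1) := by
  classical
  have hL := lapF_isStieltjes (S₁ := S₁) hG hS₀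
  have hr := hL.inv_diag_pos i
  have hdeg : lapF G S₀ S₁ i i ≤ (Fintype.card V : ℝ) - 1 := by
    have h1 : lapF G S₀ S₁ i i = G.degree i.1 := by rw [lapF_diag]
    have h2 : (G.degree i.1 : ℝ) + 1 ≤ Fintype.card V := by
      exact_mod_cast G.degree_lt_card_verts i.1
    linarith
  have h2 := one_le_diag_mul_inv_diag hL.posDef i
  have h3 : (0 : ℝ) ≤ (Fintype.card V : ℝ) - 1 := by
    have := pos_of_mul_pos_right (zero_lt_one.trans_le h2) hr.le
    linarith
  exact h2.trans (mul_le_mul (hL.inv_diag_le_inv_mulVec_one i) hdeg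
    (pos_of_mul_pos_right (zero_lt_one.trans_le h2) hr.le).le (hL.inv_mulVec_one_pos i).le)

lemma approxSol_one {G : SimpleGraph V} (hG : G.Connected) (hdisj : Disjoint S₀ S₁)
    (hS₀ : S₀.Nonempty) (hS₁ : S₁.Nonempty) {ε : ℝ} (hε : 0 < ε) {h : Follower S₀ S₁ → ℝ}
    (hh : IsApproxSol (lapF G S₀ S₁) (fun _ => 1) (delta1 (Fintype.card V) ε) h)
    (i : Follower S₀ S₁) :
    |h i - ((lapF G S₀ S₁)⁻¹ *ᵥ fun _ => 1) i| ≤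
      ε / 32 * ((lapF G S₀ S₁)⁻¹ *ᵥ fun _ => 1) i := by
  have : Nonempty (Follower S₀ S₁) := ⟨i⟩
  have hn := three_le_card hdisj hS₀ hS₁
  have hN := card_follower_le hdisj hS₀ hS₁
  have hL := lapF_isStieltjes (S₁ := S₁) hG hS₀
  have hs := sum_inv_lapF_one_le (S₁ := S₁) hG hS₀
  have h1 := one_le_inv_lapF_mul (S₁ := S₁) hG hS₀ i
  have hrg := hL.inv_diag_le_inv_mulVec_one i
  have hd := delta1_pos (n := Fintype.card V) hn hε
  have hs0 : 0 ≤ ∑ j, ((lapF G S₀ S₁)⁻¹ *ᵥ fun _ => 1) j :=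
    Finset.sum_nonneg fun j _ => (hL.inv_mulVec_one_pos j).le
  have e1 : energyNorm (lapF G S₀ S₁) ((lapF G S₀ S₁)⁻¹ *ᵥ fun _ => 1) =
      √(∑ j, ((lapF G S₀ S₁)⁻¹ *ᵥ fun _ => 1) j) := by
    rw [energyNorm, posDef_mulVec_inv hL.posDef, dotProduct]
    simp only [mul_one]
  have e2 := sqrt_mul_sqrt_le (hL.inv_diag_pos i).le hrg (by linarith) (Nat.cast_nonneg _) h1 hs0 hs
  have e3 := delta1_mul_le hn hε hN
  have e4 := (abs_le_sqrt_mul_energyNorm hL.posDef (h - (lapF G S₀ S₁)⁻¹ *ᵥ fun _ => 1) i).trans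
    (mul_le_mul_of_nonneg_left hh (Real.sqrt_nonneg _))
  rw [e1] at e4
  have hg0 := (hL.inv_mulVec_one_pos i).le
  change |h i - ((lapF G S₀ S₁)⁻¹ *ᵥ fun _ => 1) i| ≤ _ at e4
  generalize ((lapF G S₀ S₁)⁻¹ *ᵥ fun _ => 1) i = g at *
  refine e4.trans ?_
  rw [mul_left_comm]
  refine (mul_le_mul_of_nonneg_left e2 hd.le).trans ?_
  rw [mul_left_comm, mul_comm]
  exact mul_le_mul_of_nonneg_right e3 hg0

/-- The squared energy norm of the opinions is `bᵀ q ≤ N |S₁| ≤ (n - 1) ^ 2 / 4`. The factor `√r_i`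
is kept because it drops to at most `1` once an edge has been added at `i`. -/
lemma approxSol_bVec {G : SimpleGraph V} (hG : G.Connected) (hdisj : Disjoint S₀ S₁)
    (hS₀ : S₀.Nonempty) (hS₁ : S₁.Nonempty) {ε η : ℝ} (hε : 0 < ε) (hη : η < 1)
    {q : Follower S₀ S₁ → ℝ}
    (hq : IsApproxSol (lapF G S₀ S₁) (bVec G S₀ S₁) (delta2 (Fintype.card V) ε η) q)
    (i : Follower S₀ S₁) :
    |q i - followerOpinion G S₀ S₁ i| ≤
      √((lapF G S₀ S₁)⁻¹ i i) * opinionErr (Fintype.card V) ε η := by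
  classical
  have : Nonempty (Follower S₀ S₁) := ⟨i⟩
  have hn := three_le_card hdisj hS₀ hS₁
  have hL := lapF_isStieltjes (S₁ := S₁) hG hS₀
  have hd := delta2_pos (n := Fintype.card V) hn hε hη
  have hb0 : ∀ j, 0 ≤ bVec G S₀ S₁ j := fun j => Nat.cast_nonneg _
  have hq1 : ∀ j, followerOpinion G S₀ S₁ j ≤ 1 := fun j => by
    have := one_sub_qSol_nonneg hL (b := bVec G S₀ S₁) (D := 0)
      (by rw [lapF_mulVec_one]; exact bVec_le_wVec G) le_rfl j
    have e0 : diagonal (0 : Follower S₀ S₁ → ℝ) = 0 := Matrix.diagonal_zero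
    simp only [qSol, e0, add_zero] at this
    simp only [followerOpinion]; linarith
  have e : energyNorm (lapF G S₀ S₁) (followerOpinion G S₀ S₁) ≤ ((Fintype.card V : ℝ) - 1) / 2 := by
    refine Real.sqrt_le_iff.2 ⟨by linarith, ?_⟩
    rw [followerOpinion, energy_inv hL.posDef, ← followerOpinion, dotProduct]
    calc ∑ j, bVec G S₀ S₁ j * followerOpinion G S₀ S₁ j ≤ ∑ j : Follower S₀ S₁, (S₁.card : ℝ) :=
          Finset.sum_le_sum fun j _ =>
            (mul_le_of_le_one_right (hb0 j) (hq1 j)).trans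
              (Nat.cast_le.2 (Finset.card_filter_le _ _))
      _ = Fintype.card (Follower S₀ S₁) * (S₁.card : ℝ) := by simp
      _ ≤ ((Fintype.card V : ℝ) - 1) ^ 2 / 4 := card_follower_mul_le hdisj hS₀
      _ = _ := by ring
  calc |q i - followerOpinion G S₀ S₁ i|
      ≤ √((lapF G S₀ S₁)⁻¹ i i) * energyNorm (lapF G S₀ S₁) (q - followerOpinion G S₀ S₁) :=
        abs_le_sqrt_mul_energyNorm hL.posDef (q - followerOpinion G S₀ S₁) i
    _ ≤ √((lapF G S₀ S₁)⁻¹ i i) * (delta2 (Fintype.card V) ε η *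
          energyNorm (lapF G S₀ S₁) (followerOpinion G S₀ S₁)) :=
        mul_le_mul_of_nonneg_left hq (Real.sqrt_nonneg _)
    _ ≤ √((lapF G S₀ S₁)⁻¹ i i) *
          (delta2 (Fintype.card V) ε η * (((Fintype.card V : ℝ) - 1) / 2)) := by gcongr
    _ ≤ _ := by gcongr; exact delta2_mul_le hn hε hη

lemma card_FEdge_le (G : SimpleGraph V) :
    Fintype.card (FEdge G S₀ S₁) ≤ Fintype.card (Follower S₀ S₁) ^ 2 := by
  have h : Function.Injective fun e : FEdge G S₀ S₁ => Quot.out e.1 := fun e f h =>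
    Subtype.ext (by
      have h' : Quot.out e.1 = Quot.out f.1 := h
      rw [← Quot.out_eq e.1, ← Quot.out_eq f.1, h'])
  refine (Fintype.card_le_of_injective _ h).trans (le_of_eq ?_)
  rw [Fintype.card_prod, sq]

/-- The estimates `d` of the marginal gains are products of an estimate `α` of the gain coefficient
with small relative error and an estimate `u` of `1 - x_i(∞)` with small additive error. -/
def IsAccurate (G : SimpleGraph V) (S₀ S₁ : Finset V) (ε θ : ℝ) {R : Finset (Cand S₀ S₁)}
    (d : {e : Cand S₀ S₁ // e ∈ R} → ℝ) : Prop :=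
  ∀ e, ∃ α u : ℝ, d e = α * u ∧
    (1 - ε / 32) / (1 + ε / 8) * (((lapF G S₀ S₁)⁻¹ *ᵥ fun _ => 1) e.1.1 /
      (1 + (lapF G S₀ S₁)⁻¹ e.1.1 e.1.1)) ≤ α ∧
    α ≤ (1 + ε / 32) / (1 - ε / 8) * (((lapF G S₀ S₁)⁻¹ *ᵥ fun _ => 1) e.1.1 /
      (1 + (lapF G S₀ S₁)⁻¹ e.1.1 e.1.1)) ∧
    |u - (1 - followerOpinion G S₀ S₁ e.1.1)| ≤ √((lapF G S₀ S₁)⁻¹ e.1.1 e.1.1) * θ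

/-- The two squared lengths add up to `r_i`, so the errors add up to `ε / 12 + 2 ε / 96 = 5 ε / 48`,
below `ε / 8`. -/
lemma sketched_resistance {G : SimpleGraph V} (hG : G.Connected) (hdisj : Disjoint S₀ S₁)
    (hS₀ : S₀.Nonempty) (hS₁ : S₁.Nonempty) {ε : ℝ} (hε : 0 < ε) (hε1 : ε < 1 / 2) {t : ℕ}
    {P : Matrix (Fin t) (FEdge G S₀ S₁) ℝ} {P' : Matrix (Fin t) (Follower S₀ S₁) ℝ}
    (hP : P ∈ (randomSigns t (FEdge G S₀ S₁)).support)
    (hP' : P' ∈ (randomSigns t (Follower S₀ S₁)).support)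
    {X Y : Fin t → Follower S₀ S₁ → ℝ}
    (hX : ∀ j, IsApproxSol (lapF G S₀ S₁) ((P * incF G S₀ S₁) j) (delta3 (Fintype.card V) ε) (X j))
    (hY : ∀ j, IsApproxSol (lapF G S₀ S₁) ((P' * diagonal fun i => √(wVec G S₀ S₁ i)) j)
      (delta3 (Fintype.card V) ε) (Y j)) (i : Follower S₀ S₁)
    (hJ : ¬ Distorts P (ε / 12) (incF G S₀ S₁ *ᵥ ((lapF G S₀ S₁)⁻¹ *ᵥ Pi.single i 1)))
    (hJ' : ¬ Distorts P' (ε / 12) ((diagonal fun i => √(wVec G S₀ S₁ i)) *ᵥ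
      ((lapF G S₀ S₁)⁻¹ *ᵥ Pi.single i 1))) :
    |(∑ j, X j i ^ 2 + ∑ j, Y j i ^ 2) - (lapF G S₀ S₁)⁻¹ i i| ≤
      ε / 8 * (lapF G S₀ S₁)⁻¹ i i := by
  have : Nonempty (Follower S₀ S₁) := ⟨i⟩
  have hn := three_le_card hdisj hS₀ hS₁
  have hN := card_follower_le hdisj hS₀ hS₁
  have hL := lapF_isStieltjes (S₁ := S₁) hG hS₀
  have hN0 : (1 : ℝ) ≤ Fintype.card (Follower S₀ S₁) := by exact_mod_cast Fintype.card_pos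
  have hm : (Fintype.card (FEdge G S₀ S₁) : ℝ) ≤ (Fintype.card V : ℝ) ^ 2 := by
    have : (Fintype.card (FEdge G S₀ S₁) : ℝ) ≤ (Fintype.card (Follower S₀ S₁) : ℝ) ^ 2 := by
      exact_mod_cast card_FEdge_le G
    nlinarith
  have hm' : (Fintype.card (Follower S₀ S₁) : ℝ) ≤ (Fintype.card V : ℝ) ^ 2 := by nlinarith
  have hen := lapF_energy_eq (S₀ := S₀) (S₁ := S₁) G
  have hK : ∀ x, ∑ k, (incF G S₀ S₁ *ᵥ x) k ^ 2 ≤ x ⬝ᵥ (lapF G S₀ S₁ *ᵥ x) := fun x => by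
    rw [hen]; exact le_add_of_nonneg_right (Finset.sum_nonneg fun _ _ => sq_nonneg _)
  have hK' : ∀ x, ∑ k, ((diagonal fun i => √(wVec G S₀ S₁ i)) *ᵥ x) k ^ 2 ≤
      x ⬝ᵥ (lapF G S₀ S₁ *ᵥ x) := fun x => by
    rw [hen]; simp only [mulVec_diagonal]
    exact le_add_of_nonneg_left (Finset.sum_nonneg fun _ _ => sq_nonneg _)
  have hx := sketch_column_error hL.posDef hK (sum_sq_le_of_mem_support hP) hε hε1
    (delta3_sq_mul_le hn hε hε1 hm) hX i hJ
  have hy := sketch_column_error hL.posDef hK' (sum_sq_le_of_mem_support hP') hε hε1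
    (delta3_sq_mul_le hn hε hε1 hm') hY i hJ'
  have hr := inv_diag_energy hL.posDef i
  rw [hen] at hr
  simp only [mulVec_diagonal] at hy
  rw [abs_le] at hx hy ⊢
  have hr0 := hL.inv_diag_pos i
  have := mul_pos hε hr0
  rw [← hr] at this ⊢
  rw [← hr] at hx hy
  constructor <;> linarith [hx.1, hx.2, hy.1, hy.2]

lemma isAccurate_of_estimates {G : SimpleGraph V} (hG : G.Connected) (hS₀ : S₀.Nonempty)
    {ε θ : ℝ} (hε : 0 < ε) (hε1 : ε < 1 / 2) (R : Finset (Cand S₀ S₁))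
    {h q ρ : Follower S₀ S₁ → ℝ}
    (hh : ∀ i, |h i - ((lapF G S₀ S₁)⁻¹ *ᵥ fun _ => 1) i| ≤
      ε / 32 * ((lapF G S₀ S₁)⁻¹ *ᵥ fun _ => 1) i)
    (hq : ∀ i, |q i - followerOpinion G S₀ S₁ i| ≤ √((lapF G S₀ S₁)⁻¹ i i) * θ)
    (hρ : ∀ i, |ρ i - (lapF G S₀ S₁)⁻¹ i i| ≤ ε / 8 * (lapF G S₀ S₁)⁻¹ i i) :
    IsAccurate G S₀ S₁ ε θ (R := R) fun e => h e.1.1 * (1 - q e.1.1) / (1 + ρ e.1.1) := by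
  intro e
  have hL := lapF_isStieltjes (S₁ := S₁) hG hS₀
  set i := e.1.1
  have hr0 := hL.inv_diag_pos i
  have hg0 := hL.inv_mulVec_one_pos i
  have h1 := abs_le.1 (hh i)
  have h3 := abs_le.1 (hρ i)
  set g := ((lapF G S₀ S₁)⁻¹ *ᵥ fun _ => 1) i
  set r := (lapF G S₀ S₁)⁻¹ i i
  refine ⟨h i / (1 + ρ i), 1 - q i, by ring, ?_, ?_, ?_⟩
  · rw [div_mul_div_comm]
    have : 0 < 1 - ε / 8 := by linarith
    apply div_le_div₀ <;> nlinarith [h1.1, h1.2, h3.1, h3.2, mul_pos hε hg0, mul_pos hε hr0]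
  · rw [div_mul_div_comm]
    have : 0 < 1 - ε / 8 := by linarith
    apply div_le_div₀ <;> nlinarith [h1.1, h1.2, h3.1, h3.2, mul_pos hε hg0, mul_pos hε hr0]
  · have : 1 - q i - (1 - followerOpinion G S₀ S₁ i) = -(q i - followerOpinion G S₀ S₁ i) := by ring
    rw [this, abs_neg]
    exact hq i

/-- `opinionComp` is accurate, except with small probability. -/
lemma opinionComp_fail_le {G : SimpleGraph V} (hG : G.Connected) (hdisj : Disjoint S₀ S₁)
    (hS₀ : S₀.Nonempty) (hS₁ : S₁.Nonempty) [Nonempty (Follower S₀ S₁)]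
    {ε η : ℝ} (hε : 0 < ε) (hε1 : ε < 1 / 2) (hη : η < 1)
    {Solve : Solver (Follower S₀ S₁)} {p : ℝ} (hp : 0 ≤ p) (hSolve : IsSolver Solve p)
    (R : Finset (Cand S₀ S₁)) :
    (opinionComp Solve ε η G R).toOuterMeasure
      {d | ¬ IsAccurate G S₀ S₁ ε (opinionErr (Fintype.card V) ε η) d} ≤
      ENNReal.ofReal (4 / (Fintype.card (Follower S₀ S₁) : ℝ) ^ 3 +
        (2 * (sketchDim (Fintype.card (Follower S₀ S₁)) ε : ℝ) + 2) * p) := by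
  have hn := three_le_card hdisj hS₀ hS₁
  have hL := lapF_isStieltjes (S₁ := S₁) hG hS₀
  set t := sketchDim (Fintype.card (Follower S₀ S₁)) ε
  set N : ℝ := (Fintype.card (Follower S₀ S₁) : ℝ)
  have htN : 24 * Real.log N / (ε / 12) ^ 2 ≤ t := Nat.le_ceil _
  have hN0 : 0 ≤ N := Nat.cast_nonneg _
  set a := ENNReal.ofReal (2 / N ^ 3)
  set b := ENNReal.ofReal p
  -- One summand per random choice, in the order of the draws: two sketches, two single solves, two
  -- batches of `t` solves, and the final `pure`.
  have hsum : ENNReal.ofReal (4 / N ^ 3 + (2 * (t : ℝ) + 2) * p) =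
      a + (a + (b + (b + (t * b + (t * b + 0))))) := by
    simp only [a, b, ← ENNReal.ofReal_natCast, ← ENNReal.ofReal_zero]
    have hN3 : 0 ≤ 2 / N ^ 3 := by positivity
    have htp : 0 ≤ (t : ℝ) * p := by positivity
    rw [← ENNReal.ofReal_mul (Nat.cast_nonneg _), ← ENNReal.ofReal_add htp le_rfl,
      ← ENNReal.ofReal_add htp (by positivity), ← ENNReal.ofReal_add hp (by positivity),
      ← ENNReal.ofReal_add hp (by positivity), ← ENNReal.ofReal_add hN3 (by positivity),
      ← ENNReal.ofReal_add hN3 (by positivity)]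
    congr 1; ring
  rw [hsum]
  unfold opinionComp
  have hd3 := delta3_pos (n := Fintype.card V) hn hε hε1
  refine toOuterMeasure_bind_le (randomSigns_exists_distorts_le
    (fun i => incF G S₀ S₁ *ᵥ ((lapF G S₀ S₁)⁻¹ *ᵥ Pi.single i 1)) (by positivity)
    (by linarith) htN) fun P hP hPJ => ?_
  refine toOuterMeasure_bind_le (randomSigns_exists_distorts_le
    (fun i => (diagonal fun i => √(wVec G S₀ S₁ i)) *ᵥ ((lapF G S₀ S₁)⁻¹ *ᵥ Pi.single i 1))
    (by positivity) (by linarith) htN) fun P' hP' hPJ' => ?_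
  refine toOuterMeasure_bind_le (solve_fail_le hSolve hL.posDef _ (delta1_pos hn hε))
    fun h _ hh => ?_
  refine toOuterMeasure_bind_le (solve_fail_le hSolve hL.posDef _ (delta2_pos hn hε hη))
    fun q _ hq => ?_
  refine toOuterMeasure_bind_le (solveRows_fail_le hSolve hL.posDef hd3 t _) fun X _ hX => ?_
  refine toOuterMeasure_bind_le (solveRows_fail_le hSolve hL.posDef hd3 t _) fun Y _ hY => ?_
  refine toOuterMeasure_pure_le ?_ _
  simp only [Set.mem_ofPred_eq, not_not, not_exists] at hh hq hPJ hPJ' ⊢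
  have := isAccurate_of_estimates hG hS₀ hε hε1 R (approxSol_one hG hdisj hS₀ hS₁ hε hh)
    (approxSol_bVec hG hdisj hS₀ hS₁ hε hη hq)
    (fun i => sketched_resistance hG hdisj hS₀ hS₁ hε hε1 hP hP' (not_not.1 hX) (not_not.1 hY) i
      (hPJ i) (hPJ' i))
  simpa only [← add_assoc] using this

end Comp

/-! Greedy selection with inaccurate gains. -/

section Greedy

variable {V : Type*} [Fintype V] [DecidableEq V] {S₀ S₁ : Finset V}
  {M : Matrix (Follower S₀ S₁) (Follower S₀ S₁) ℝ} {b : Follower S₀ S₁ → ℝ}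

/-- The total opinion of the followers after adding the edges `T` to the system `M q = b`. -/
def totalOpinion (M : Matrix (Follower S₀ S₁) (Follower S₀ S₁) ℝ) (b : Follower S₀ S₁ → ℝ)
    (T : Finset (Cand S₀ S₁)) : ℝ :=
  ∑ i, qSol M b (addCount T) i

lemma totalOpinion_mono (hM : IsStieltjes M) (hb : b ≤ M *ᵥ fun _ => 1)
    {T T' : Finset (Cand S₀ S₁)} (h : T ⊆ T') : totalOpinion M b T ≤ totalOpinion M b T' :=
  Finset.sum_le_sum fun i _ => qSol_mono hM hb (addCount_nonneg T) (addCount_mono h) i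

/-- The gain of a set of edges as a sum over its edges. -/
lemma totalOpinion_sub (hM : IsStieltjes M) {T T' : Finset (Cand S₀ S₁)} (h : T ⊆ T') :
    totalOpinion M b T' - totalOpinion M b T =
      ∑ c ∈ T' \ T, hSol M (addCount T') c.1 * (1 - qSol M b (addCount T) c.1) := by
  have e : addCount T' = addCount T + addCount (T' \ T) := by
    rw [← addCount_disjUnion Finset.disjoint_sdiff, Finset.union_sdiff_of_subset h]
  rw [totalOpinion, totalOpinion, sum_qSol_sub hM (addCount_nonneg T) (addCount_mono h),
    ← sum_mul_addCount (T' \ T)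
      (fun i => hSol M (addCount T') i * (1 - qSol M b (addCount T) i))]
  refine Finset.sum_congr rfl fun i _ => ?_
  have : addCount T' i - addCount T i = addCount (T' \ T) i := by rw [e]; simp
  rw [this]; ring

lemma totalOpinion_insert_sub (hM : IsStieltjes M) {T : Finset (Cand S₀ S₁)} {e : Cand S₀ S₁}
    (he : e ∉ T) : totalOpinion M b (insert e T) - totalOpinion M b T =
      gainCoeff M (addCount T) e.1 * (1 - qSol M b (addCount T) e.1) := by
  rw [totalOpinion, totalOpinion, addCount_insert he, sum_qSol_add_single hM (addCount_nonneg T)]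

/-- The remaining gain is bounded by the largest gain with its error removed. -/
lemma totalOpinion_gap_le (hM : IsStieltjes M) (hb : b ≤ M *ᵥ fun _ => 1)
    {T Tstar : Finset (Cand S₀ S₁)} {ν s g : ℝ} (hν : 0 < ν)
    (hT0 : ∀ c ∈ Tstar, ν ≤ 1 - qSol M b (addCount ∅) c.1) (hs : 0 ≤ s) (hg : 0 ≤ g)
    (hgain : ∀ c ∈ Tstar \ T,
      gainCoeff M (addCount T) c.1 * (1 - qSol M b (addCount T) c.1 - s) ≤ g) :
    totalOpinion M b Tstar - totalOpinion M b T ≤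
      Tstar.card * g + s / ν * (totalOpinion M b Tstar - totalOpinion M b ∅) := by
  set U := T ∪ Tstar
  have hTU : T ⊆ U := Finset.subset_union_left
  have hsU : Tstar ⊆ U := Finset.subset_union_right
  have hW : U \ T = Tstar \ T := Finset.union_sdiff_left T Tstar
  have hpos : ∀ i, 0 < hSol M (addCount U) i := hSol_pos hM (addCount_nonneg U)
  have h1 := totalOpinion_mono hM hb hsU
  have h2 := totalOpinion_sub (b := b) hM hTU
  rw [hW] at h2
  have h3 : ∀ c ∈ Tstar \ T, hSol M (addCount U) c.1 * (1 - qSol M b (addCount T) c.1) ≤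
      g + s * hSol M (addCount U) c.1 := by
    intro c hc
    have hcT := (Finset.mem_sdiff.1 hc).2
    -- Submodularity: `U` contains `insert c T`, and the coefficient of `c` is `hSol` at `insert c
    -- T`.
    have hcoef : hSol M (addCount U) c.1 ≤ gainCoeff M (addCount T) c.1 := by
      rw [← hSol_add_single hM (addCount_nonneg T), ← addCount_insert hcT]
      exact hSol_antitone hM (addCount_nonneg _)
        (addCount_mono (Finset.insert_subset (hsU (Finset.mem_sdiff.1 hc).1) hTU)) _
    have h4 := hgain c hc
    have h5 := hpos c.1
    -- The reduced factor may be negative, and then coefficients cannot be compared; but the left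
    -- side is already at most `s * hSol`.
    rcases le_total (1 - qSol M b (addCount T) c.1 - s) 0 with h6 | h6
    · nlinarith [mul_nonneg h5.le (neg_nonneg.2 h6)]
    · nlinarith [mul_le_mul_of_nonneg_right hcoef h6]
  have h4 : ∑ c ∈ Tstar \ T, (g + s * hSol M (addCount U) c.1) ≤
      Tstar.card * g + s * ∑ c ∈ Tstar \ T, hSol M (addCount U) c.1 := by
    rw [Finset.sum_add_distrib, Finset.sum_const, nsmul_eq_mul, ← Finset.mul_sum]
    have : ((Tstar \ T).card : ℝ) ≤ Tstar.card :=
      Nat.cast_le.2 (Finset.card_le_card Finset.sdiff_subset)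
    gcongr
  -- The accumulated error weights are absorbed by the optimal gain itself, because `1 - q ≥ ν` on
  -- `Tstar` before any addition.
  have h5 : ν * ∑ c ∈ Tstar \ T, hSol M (addCount U) c.1 ≤
      totalOpinion M b Tstar - totalOpinion M b ∅ := by
    rw [totalOpinion_sub hM (Finset.empty_subset Tstar), Finset.sdiff_empty, Finset.mul_sum]
    have hp' : ∀ i, 0 < hSol M (addCount Tstar) i := hSol_pos hM (addCount_nonneg Tstar)
    refine (Finset.sum_le_sum fun c hc => ?_).trans
      (Finset.sum_le_sum_of_subset_of_nonneg Finset.sdiff_subset fun c hc _ =>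
        mul_nonneg (hp' c.1).le (hν.le.trans (hT0 c hc)))
    rw [mul_comm]
    exact mul_le_mul (hSol_antitone hM (addCount_nonneg _) (addCount_mono hsU) _)
      (hT0 c (Finset.mem_sdiff.1 hc).1) hν.le (hp' c.1).le
  have h6 : s * ∑ c ∈ Tstar \ T, hSol M (addCount U) c.1 ≤
      s / ν * (totalOpinion M b Tstar - totalOpinion M b ∅) := by
    rw [div_mul_eq_mul_div, le_div_iff₀ hν, mul_assoc, mul_comm _ ν]
    exact mul_le_mul_of_nonneg_left h5 hs
  have h7 := Finset.sum_le_sum h3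
  linarith

/-- Adding `e` alone gains at least `ν` times its initial coefficient when `ν ≥ 0`. Completing `{e}`
to a competitor of the size of `Tstar` shows that this is at most the optimal gain, and the
coefficient only decreases later. -/
lemma gainCoeff_mul_le (hM : IsStieltjes M) (hb : b ≤ M *ᵥ fun _ => 1)
    {Q Tstar : Finset (Cand S₀ S₁)} {ν : ℝ}
    (hQ : ∀ c ∈ Q, ν ≤ 1 - qSol M b (addCount ∅) c.1) (hk0 : 0 < Tstar.card) (hTQ : Tstar ⊆ Q)
    (hopt : ∀ P ⊆ Q, P.card = Tstar.card → totalOpinion M b P ≤ totalOpinion M b Tstar)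
    (T : Finset (Cand S₀ S₁)) {e : Cand S₀ S₁} (he : e ∈ Q) :
    gainCoeff M (addCount T) e.1 * ν ≤ totalOpinion M b Tstar - totalOpinion M b ∅ := by
  obtain ⟨P, heP, hPQ, hP⟩ := Finset.exists_subsuperset_card_eq
    (s := {e}) (t := Q) (n := Tstar.card) (by simpa using he) (by simpa using hk0)
    (Finset.card_le_card hTQ)
  have h1 := hopt P hPQ hP
  have h2 := totalOpinion_mono hM hb heP
  have h3 := totalOpinion_insert_sub (b := b) hM (Finset.notMem_empty e)
  rw [insert_empty_eq] at h3
  have h4 := gainCoeff_antitone hM (addCount_nonneg _) (addCount_mono (Finset.empty_subset T)) e.1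
  have h5 := gainCoeff_pos hM (addCount_nonneg T) e.1
  have h6 := gainCoeff_pos hM (addCount_nonneg (∅ : Finset (Cand S₀ S₁))) e.1
  have h7 := mul_le_mul_of_nonneg_left (hQ e he) h6.le
  rcases le_total ν 0 with h | h
  · have := totalOpinion_mono hM hb (Finset.empty_subset Tstar)
    nlinarith
  · have := mul_le_mul_of_nonneg_right h4 h
    linarith

/-- Comparing two inaccurate gains bounds the true ones. -/
lemma gain_le_of_estimate_le {lo hi ce cf ue uf se sf αe αf ve vf : ℝ} (hlo : 0 < lo)
    (hce : 0 < ce) (hcf : 0 < cf) (hue : 0 ≤ ue) (hse : 0 ≤ se)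
    (hαe : lo * ce ≤ αe) (hαe' : αe ≤ hi * ce) (hαf : lo * cf ≤ αf)
    (hve : |ve - ue| ≤ se) (hvf : |vf - uf| ≤ sf) (h : αf * vf ≤ αe * ve) :
    cf * (uf - sf) ≤ hi / lo * (ce * ue + ce * se) := by
  have hαe0 : 0 < αe := lt_of_lt_of_le (by positivity) hαe
  have hhi : 0 < hi := pos_of_mul_pos_left (hαe0.trans_le hαe') hce.le
  rw [abs_le] at hve hvf
  rcases le_or_gt (uf - sf) 0 with h0 | h0
  · exact (mul_nonpos_of_nonneg_of_nonpos hcf.le h0).trans (by positivity)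
  · have h1 : lo * cf * (uf - sf) ≤ αf * vf :=
      mul_le_mul hαf (by linarith [hvf.1]) h0.le
        ((by positivity : (0 : ℝ) ≤ lo * cf).trans hαf)
    have h2 : 0 < lo * cf * (uf - sf) := by positivity
    have h3 : 0 < ve := pos_of_mul_pos_right (h2.trans_le (h1.trans h)) hαe0.le
    have h4 : αe * ve ≤ hi * ce * (ue + se) :=
      mul_le_mul hαe' (by linarith [hve.2]) h3.le (by positivity)
    rw [div_mul_eq_mul_div, le_div_iff₀ hlo]
    linarith

/-- The ratio of upper to lower relative error is `1 + 5 ε / 16` to first order, which `1 - ε / 3`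
compensates. -/
lemma greedy_ratio_le {ε : ℝ} (hε : 0 < ε) (hε1 : ε < 1 / 2) :
    (1 - ε / 3) * ((1 + ε / 32) / (1 - ε / 8) / ((1 - ε / 32) / (1 + ε / 8))) ≤ 1 := by
  have h1 : 0 < 1 - ε / 8 := by linarith
  have h2 : 0 < 1 - ε / 32 := by linarith
  rw [div_div_div_eq, ← mul_div_assoc, div_le_one (by positivity)]
  nlinarith [mul_pos hε hε, mul_pos (mul_pos hε hε) hε]

/-- Weight of the additive errors committed while selecting `T`. -/
def errorWeight (n : ℕ) (T : Finset (Cand S₀ S₁)) : ℝ :=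
  ((T.image fun c => c.1).card : ℝ) * (n / 2) + T.card

lemma sqrt_le_half {n r : ℝ} (hn : 0 ≤ n) (hr : r ≤ n - 1) : √r ≤ n / 2 :=
  Real.sqrt_le_iff.2 ⟨by linarith, by nlinarith [sq_nonneg (n - 2)]⟩

/-- The first edge at a follower pays `√(n - 1) ≤ n / 2`; each later edge there pays at most `1`, as
the diagonal has already grown by one. The payments telescope over the rounds. -/
lemma sqrt_inv_diag_le (hM : IsStieltjes M) {n : ℕ} {T : Finset (Cand S₀ S₁)} {e : Cand S₀ S₁}
    (he : e ∉ T) (hr : (M + diagonal (addCount T))⁻¹ e.1 e.1 ≤ (n : ℝ) - 1) :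
    √((M + diagonal (addCount T))⁻¹ e.1 e.1) ≤
      errorWeight n (insert e T) - errorWeight n T := by
  rw [errorWeight, errorWeight, Finset.card_insert_of_notMem he, Finset.image_insert]
  have hn : (0 : ℝ) ≤ n := Nat.cast_nonneg n
  by_cases h : e.1 ∈ T.image fun c => c.1
  · rw [Finset.insert_eq_of_mem h]
    push_cast
    have h1 : 1 ≤ addCount T e.1 := by
      obtain ⟨c, hc, hce⟩ := Finset.mem_image.1 h
      have : 0 < (T.filter fun c => c.1 = e.1).card :=
        Finset.card_pos.2 ⟨c, Finset.mem_filter.2 ⟨hc, hce⟩⟩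
      simp only [addCount]
      exact_mod_cast this
    have h2 := hM.inv_diag_le_one (addCount_nonneg T) h1
    have h3 : √((M + diagonal (addCount T))⁻¹ e.1 e.1) ≤ 1 := Real.sqrt_le_one.2 h2
    linarith
  · rw [Finset.card_insert_of_notMem h]
    push_cast
    have h3 := sqrt_le_half hn hr
    linarith

lemma errorWeight_le (hdisj : Disjoint S₀ S₁) (hS₀ : S₀.Nonempty) (hS₁ : S₁.Nonempty)
    [Nonempty (Follower S₀ S₁)] (T : Finset (Cand S₀ S₁)) :
    errorWeight (Fintype.card V) T ≤ 3 / 4 * (Fintype.card V : ℝ) ^ 2 := by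
  have hn := three_le_card hdisj hS₀ hS₁
  have hN := card_follower_le hdisj hS₀ hS₁
  have h1 : ((T.image fun c => c.1).card : ℝ) ≤ Fintype.card (Follower S₀ S₁) :=
    Nat.cast_le.2 (Finset.card_le_univ _)
  have h2 : (T.card : ℝ) ≤ Fintype.card (Follower S₀ S₁) * (S₁.card : ℝ) := by
    have h3 := Finset.card_le_univ T
    rw [Fintype.card_prod, Fintype.card_coe] at h3
    exact_mod_cast h3
  have h3 := card_follower_mul_le hdisj hS₀
  have h4 : ((T.image fun c => c.1).card : ℝ) * ((Fintype.card V : ℝ) / 2) ≤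
      ((Fintype.card V : ℝ) - 2) * ((Fintype.card V : ℝ) / 2) := by
    have := h1.trans hN
    gcongr
  rw [errorWeight]
  nlinarith

/-- One step of the recursion for the distance to the optimum. -/
lemma greedy_recursion {A D β κ k j w w' dist dist' gain g E : ℝ} (hk : 1 ≤ k) (hκ0 : 0 ≤ κ)
    (hκ1 : κ ≤ 1) (hβ : 0 ≤ β) (hj : 0 ≤ j) (hw : 0 ≤ w) (hD : 0 ≤ D)
    (hdist : dist ≤ (A + j / k * β + w) * D) (hdist' : dist' = dist - gain)
    (hgap : dist ≤ k * g + β * D) (hgain : κ * g - E ≤ gain) (hE : E ≤ (w' - w) * D) :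
    dist' ≤ (A * (1 - κ / k) + (j + 1) / k * β + w') * D := by
  have hk0 : 0 < k := by linarith
  have h1 : (dist - β * D) / k ≤ g := by rw [div_le_iff₀ hk0]; linarith
  have h2 : κ * ((dist - β * D) / k) ≤ κ * g := mul_le_mul_of_nonneg_left h1 hκ0
  have h3 : κ / k ≤ 1 := by rw [div_le_one hk0]; linarith
  have h4 : 0 ≤ κ / k := by positivity
  have h5 : (1 - κ / k) * dist ≤ (1 - κ / k) * ((A + j / k * β + w) * D) :=
    mul_le_mul_of_nonneg_left hdist (by linarith)
  have h6 : 0 ≤ κ / k * ((j / k * β + w) * D) := by positivity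
  have h7 : κ / k * (β * D) ≤ 1 / k * (β * D) := by gcongr
  have e1 : κ * ((dist - β * D) / k) = κ / k * dist - κ / k * (β * D) := by ring
  have e2 : (j + 1) / k * β * D = j / k * β * D + 1 / k * (β * D) := by ring
  have e3 : (A * (1 - κ / k) + (j + 1) / k * β + w') * D =
      A * (1 - κ / k) * D + (j + 1) / k * β * D + w' * D := by ring
  rw [e3, e2]
  nlinarith

/-- The state reached after `j` accurate greedy rounds. -/
def GreedyInvariant (M : Matrix (Follower S₀ S₁) (Follower S₀ S₁) ℝ) (b : Follower S₀ S₁ → ℝ)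
    (ε : ℝ) (Q Tstar : Finset (Cand S₀ S₁)) (j : ℕ) (T : Finset (Cand S₀ S₁)) : Prop :=
  T ⊆ Q ∧ T.card = j ∧ totalOpinion M b Tstar - totalOpinion M b T ≤
    ((1 - (1 - ε / 3) / Tstar.card) ^ j + (j : ℝ) / Tstar.card * (ε / 24) +
      ε / (4 * (Fintype.card V : ℝ) ^ 2) * errorWeight (Fintype.card V) T) *
    (totalOpinion M b Tstar - totalOpinion M b ∅)

/-- The maximality of the selected estimate bounds every true gain in `Tstar \ T`, reduced by its
additive error, by one number `g`. The true gain of the selected edge is at least `(1 - ε / 3) g`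
minus its own additive error. -/
lemma greedyInvariant_step {G : SimpleGraph V} (hG : G.Connected) (hdisj : Disjoint S₀ S₁)
    (hS₀ : S₀.Nonempty) (hS₁ : S₁.Nonempty) [Nonempty (Follower S₀ S₁)]
    {ε η : ℝ} (hε : 0 < ε) (hε1 : ε < 1 / 2) (hη : η < 1)
    {Q Tstar : Finset (Cand S₀ S₁)} (hQnew : ∀ e ∈ Q, ¬ G.Adj e.1.1 e.2.1)
    (hQη : ∀ e ∈ Q, followerOpinion G S₀ S₁ e.1 < η)
    (hTQ : Tstar ⊆ Q) (hopt : ∀ P ⊆ Q, P.card = Tstar.card →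
      totalOpinion (lapF G S₀ S₁) (bVec G S₀ S₁) P ≤
        totalOpinion (lapF G S₀ S₁) (bVec G S₀ S₁) Tstar)
    {sel : (R : Finset (Cand S₀ S₁)) → ({e : Cand S₀ S₁ // e ∈ R} → ℝ) → Cand S₀ S₁}
    (hsel : IsArgmaxRule sel) {j : ℕ} (hj : j < Tstar.card) {T : Finset (Cand S₀ S₁)}
    (hT : GreedyInvariant (lapF G S₀ S₁) (bVec G S₀ S₁) ε Q Tstar j T)
    {d : {e : Cand S₀ S₁ // e ∈ Q \ T} → ℝ}
    (hd : IsAccurate (addEdges G T) S₀ S₁ ε (opinionErr (Fintype.card V) ε η) d) :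
    GreedyInvariant (lapF G S₀ S₁) (bVec G S₀ S₁) ε Q Tstar (j + 1)
      (insert (sel (Q \ T) d) T) := by
  obtain ⟨hTQ', hTj, hdist⟩ := hT
  have hn := three_le_card hdisj hS₀ hS₁
  have hM := lapF_isStieltjes (S₁ := S₁) hG hS₀
  have hb : bVec G S₀ S₁ ≤ lapF G S₀ S₁ *ᵥ fun _ => 1 := by
    rw [lapF_mulVec_one]; exact bVec_le_wVec G
  have hTnew : ∀ e ∈ T, ¬ G.Adj e.1.1 e.2.1 := fun e he => hQnew e (hTQ' he)
  have hL := lapF_addEdges G hTnew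
  have hrn : ∀ i, (lapF (addEdges G T) S₀ S₁)⁻¹ i i ≤ (Fintype.card V : ℝ) - 1 :=
    inv_lapF_diag_le (addEdges_connected hG T) hS₀
  have hq : followerOpinion (addEdges G T) S₀ S₁ =
      qSol (lapF G S₀ S₁) (bVec G S₀ S₁) (addCount T) := by
    rw [followerOpinion, qSol, hL, bVec_addEdges G hTnew]
  have hu0 : ∀ c ∈ Q, 1 - η ≤ 1 - qSol (lapF G S₀ S₁) (bVec G S₀ S₁) (addCount ∅) c.1 := by
    intro c hc
    have e0 : diagonal (0 : Follower S₀ S₁ → ℝ) = 0 := Matrix.diagonal_zero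
    have := hQη c hc
    rw [followerOpinion] at this
    rw [addCount_empty, qSol, e0, add_zero, add_zero]
    linarith
  rw [hL] at hrn
  unfold IsAccurate at hd
  rw [hq, hL] at hd
  set M := lapF G S₀ S₁
  set b := bVec G S₀ S₁
  have hR : (Q \ T).Nonempty := by
    rw [← Finset.card_pos, Finset.card_sdiff_of_subset hTQ']
    have := Finset.card_le_card hTQ
    omega
  obtain ⟨m, hm, hmax⟩ := hsel (Q \ T) d hR
  rw [hm]
  obtain ⟨e, heR⟩ := m
  have heQ := (Finset.mem_sdiff.1 heR).1
  have heT := (Finset.mem_sdiff.1 heR).2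
  have hν : 0 < 1 - η := by linarith
  set D := totalOpinion M b Tstar - totalOpinion M b ∅
  have hD : 0 ≤ D := sub_nonneg.2 (totalOpinion_mono hM hb (Finset.empty_subset _))
  set n : ℝ := (Fintype.card V : ℝ)
  set θ := opinionErr (Fintype.card V) ε η with hθ
  have hθ0 : 0 ≤ θ := by rw [hθ, opinionErr]; positivity
  have hθν : θ = (1 - η) * (ε / (4 * n ^ 2)) := by rw [hθ, opinionErr]; ring
  set lo := (1 - ε / 32) / (1 + ε / 8) with hlo
  set hi := (1 + ε / 32) / (1 - ε / 8) with hhi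
  have hlo0 : 0 < lo := div_pos (by linarith) (by linarith)
  have hhi0 : 0 < hi := div_pos (by linarith) (by linarith)
  set r : Follower S₀ S₁ → ℝ := fun i => (M + diagonal (addCount T))⁻¹ i i
  set u : Follower S₀ S₁ → ℝ := fun i => 1 - qSol M b (addCount T) i
  set co := gainCoeff M (addCount T)
  have hco : ∀ i, 0 < co i := gainCoeff_pos hM (addCount_nonneg T)
  have hu : ∀ i, 0 ≤ u i := one_sub_qSol_nonneg hM hb (addCount_nonneg T)
  set g := hi / lo * (co e.1 * u e.1 + co e.1 * (√(r e.1) * θ)) with hg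
  have hco1 := hco e.1
  have hu1 := hu e.1
  have hse : 0 ≤ √(r e.1) * θ := mul_nonneg (Real.sqrt_nonneg _) hθ0
  have hg0 : 0 ≤ g := by positivity
  have hgain : ∀ c ∈ Tstar \ T, co c.1 * (u c.1 - n / 2 * θ) ≤ g := by
    intro c hc
    have hcR : c ∈ Q \ T := Finset.sdiff_subset_sdiff hTQ subset_rfl hc
    obtain ⟨αe, ve, h1, h2, h3, h4⟩ := hd ⟨e, heR⟩
    obtain ⟨αf, vf, h5, h6, -, h8⟩ := hd ⟨c, hcR⟩
    have h9 := hmax ⟨c, hcR⟩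
    rw [h1, h5] at h9
    have h10 := gain_le_of_estimate_le hlo0 (hco e.1) (hco c.1) (hu e.1) hse h2 h3 h6 h4 h8 h9
    have h11 : √(r c.1) * θ ≤ n / 2 * θ :=
      mul_le_mul_of_nonneg_right (sqrt_le_half (by linarith) (hrn c.1)) hθ0
    refine le_trans (mul_le_mul_of_nonneg_left ?_ (hco c.1).le) h10
    exact sub_le_sub_left h11 _
  have hgap := totalOpinion_gap_le hM hb hν (fun c hc => hu0 c (hTQ hc))
    (by positivity : 0 ≤ n / 2 * θ) hg0 hgain
  -- The factor `1 - η` in the tolerance cancels, leaving `ε / (8 n)`, and `n ≥ 3`.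
  have hβ : n / 2 * θ / (1 - η) ≤ ε / 24 := by
    have : n / 2 * θ / (1 - η) = ε / (8 * n) := by
      rw [hθν]; field_simp; ring
    rw [this]
    gcongr
    linarith
  have hgap' : totalOpinion M b Tstar - totalOpinion M b T ≤ Tstar.card * g + ε / 24 * D :=
    hgap.trans (add_le_add_right (mul_le_mul_of_nonneg_right hβ hD) _)
  have hstep := totalOpinion_insert_sub (b := b) hM heT
  have hratio := greedy_ratio_le hε hε1
  have hκg : (1 - ε / 3) * g - co e.1 * (√(r e.1) * θ) ≤ co e.1 * u e.1 := by
    have h1 : (1 - ε / 3) * g ≤ 1 * (co e.1 * u e.1 + co e.1 * (√(r e.1) * θ)) := by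
      rw [hg, ← mul_assoc]
      exact mul_le_mul_of_nonneg_right hratio (by positivity)
    linarith
  have hw := sqrt_inv_diag_le hM heT (hrn e.1)
  have hcD := gainCoeff_mul_le hM hb hu0 (by omega) hTQ hopt T heQ
  -- The error of the selected edge is charged to the increase of `errorWeight`; the factor `1 - η`
  -- in `θ` turns the coefficient into a multiple of `D`.
  have hE : co e.1 * (√(r e.1) * θ) ≤
      (ε / (4 * n ^ 2) * errorWeight (Fintype.card V) (insert e T) -
        ε / (4 * n ^ 2) * errorWeight (Fintype.card V) T) * D := by
    rw [hθν, ← mul_sub]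
    calc co e.1 * (√(r e.1) * ((1 - η) * (ε / (4 * n ^ 2)))) =
          ε / (4 * n ^ 2) * √(r e.1) * (co e.1 * (1 - η)) := by ring
      _ ≤ ε / (4 * n ^ 2) * √(r e.1) * D := by gcongr
      _ ≤ _ := by gcongr
  have hw0 : 0 ≤ ε / (4 * n ^ 2) * errorWeight (Fintype.card V) T := by
    unfold errorWeight; positivity
  refine ⟨Finset.insert_subset heQ hTQ', by rw [Finset.card_insert_of_notMem heT, hTj], ?_⟩
  have hk : (1 : ℝ) ≤ Tstar.card := by exact_mod_cast (by omega : 1 ≤ Tstar.card)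
  have := greedy_recursion (dist' := totalOpinion M b Tstar - totalOpinion M b (insert e T))
    hk (by linarith : 0 ≤ 1 - ε / 3) (by linarith) (by positivity : 0 ≤ ε / 24)
    (Nat.cast_nonneg j) hw0 hD hdist (by rw [← hstep]; ring) hgap' hκg hE
  rw [pow_succ]
  push_cast
  exact this

/-- The guarantee after all rounds. -/
lemma greedyInvariant_final {ε : ℝ} (hε : 0 < ε) (hε1 : ε < 1 / 2)
    (hdisj : Disjoint S₀ S₁) (hS₀ : S₀.Nonempty) (hS₁ : S₁.Nonempty) [Nonempty (Follower S₀ S₁)]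
    (hM : IsStieltjes M) (hb : b ≤ M *ᵥ fun _ => 1) {Q Tstar T : Finset (Cand S₀ S₁)}
    (hk : 0 < Tstar.card) (hT : GreedyInvariant M b ε Q Tstar Tstar.card T) :
    (1 - 1 / Real.exp 1 - ε) * (totalOpinion M b Tstar - totalOpinion M b ∅) ≤
      totalOpinion M b T - totalOpinion M b ∅ := by
  obtain ⟨-, -, h⟩ := hT
  have hn := three_le_card hdisj hS₀ hS₁
  have hk' : (1 : ℝ) ≤ Tstar.card := by exact_mod_cast hk
  have hD : 0 ≤ totalOpinion M b Tstar - totalOpinion M b ∅ :=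
    sub_nonneg.2 (totalOpinion_mono hM hb (Finset.empty_subset _))
  have h1 : (1 - (1 - ε / 3) / Tstar.card) ^ Tstar.card ≤ Real.exp (-(1 - ε / 3)) :=
    Real.one_sub_div_pow_le_exp_neg (by linarith)
  have h2 : Real.exp (-(1 - ε / 3)) ≤ 1 / Real.exp 1 + ε / 2 := by
    have e1 : Real.exp (-(1 - ε / 3)) = Real.exp (-1) * Real.exp (ε / 3) := by
      rw [← Real.exp_add]; congr 1; ring
    have e2 : Real.exp (ε / 3) ≤ 1 + ε := by
      have h3 := Real.exp_bound_div_one_sub_of_interval (x := ε / 3) (by linarith) (by linarith)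
      refine h3.trans ?_
      rw [div_le_iff₀ (by linarith)]
      nlinarith
    have e3 : Real.exp (-1) ≤ 1 / 2 := by
      rw [Real.exp_neg, inv_le_comm₀ (Real.exp_pos _) (by norm_num)]
      have := Real.add_one_le_exp (1 : ℝ)
      norm_num at this ⊢
      linarith
    have e4 : 1 / Real.exp 1 = Real.exp (-1) := by rw [Real.exp_neg, one_div]
    rw [e1, e4]
    have := Real.exp_pos (-1)
    nlinarith
  have h3 : (Tstar.card : ℝ) / Tstar.card * (ε / 24) = ε / 24 := by
    rw [div_self (by linarith), one_mul]
  have h4 : ε / (4 * (Fintype.card V : ℝ) ^ 2) * errorWeight (Fintype.card V) T ≤ 3 * ε / 16 := by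
    have h5 := errorWeight_le hdisj hS₀ hS₁ T
    calc ε / (4 * (Fintype.card V : ℝ) ^ 2) * errorWeight (Fintype.card V) T
        ≤ ε / (4 * (Fintype.card V : ℝ) ^ 2) * (3 / 4 * (Fintype.card V : ℝ) ^ 2) := by gcongr
      _ = 3 * ε / 16 := by field_simp; norm_num
  rw [h3] at h
  -- The losses beyond `1 / e` are `ε / 2`, `ε / 24` and `3 ε / 16`, in total `35 ε / 48`.
  have h5 := h.trans (mul_le_mul_of_nonneg_right
    (by linarith : _ ≤ 1 / Real.exp 1 + ε) hD)
  linarith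

/-- After `j` rounds the invariant holds, except with small probability. -/
lemma approx_fail_le {G : SimpleGraph V} (hG : G.Connected) (hdisj : Disjoint S₀ S₁)
    (hS₀ : S₀.Nonempty) (hS₁ : S₁.Nonempty) [Nonempty (Follower S₀ S₁)]
    {ε η : ℝ} (hε : 0 < ε) (hε1 : ε < 1 / 2) (hη : η < 1)
    {Q Tstar : Finset (Cand S₀ S₁)} (hQnew : ∀ e ∈ Q, ¬ G.Adj e.1.1 e.2.1)
    (hQη : ∀ e ∈ Q, followerOpinion G S₀ S₁ e.1 < η)
    {Solve : Solver (Follower S₀ S₁)} {p : ℝ} (hp : 0 ≤ p) (hSolve : IsSolver Solve p)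
    {sel : (R : Finset (Cand S₀ S₁)) → ({e : Cand S₀ S₁ // e ∈ R} → ℝ) → Cand S₀ S₁}
    (hsel : IsArgmaxRule sel) (hTQ : Tstar ⊆ Q) (hopt : ∀ P ⊆ Q, P.card = Tstar.card →
      totalOpinion (lapF G S₀ S₁) (bVec G S₀ S₁) P ≤
        totalOpinion (lapF G S₀ S₁) (bVec G S₀ S₁) Tstar) (j : ℕ) (hj : j ≤ Tstar.card) :
    (approx Solve sel ε η G Q j).toOuterMeasure
      {T | ¬ GreedyInvariant (lapF G S₀ S₁) (bVec G S₀ S₁) ε Q Tstar j T} ≤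
      j * ENNReal.ofReal (4 / (Fintype.card (Follower S₀ S₁) : ℝ) ^ 3 +
        (2 * (sketchDim (Fintype.card (Follower S₀ S₁)) ε : ℝ) + 2) * p) := by
  induction j with
  | zero =>
    refine toOuterMeasure_pure_le ?_ _
    -- With no edges the bracket is `1 + 0 + 0`, so the bound is an equality.
    simp [GreedyInvariant, errorWeight]
  | succ j ih =>
    rw [approx, Nat.cast_succ, add_mul, one_mul]
    refine toOuterMeasure_bind_le (ih (by omega)) fun T _ hT => ?_
    rw [← add_zero (ENNReal.ofReal _)]
    refine toOuterMeasure_bind_le (opinionComp_fail_le (addEdges_connected hG T) hdisj hS₀ hS₁ hε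
      hε1 hη hp hSolve (Q \ T)) fun d _ hd => ?_
    refine toOuterMeasure_pure_le ?_ _
    simp only [Set.mem_ofPred_eq, not_not] at hT hd ⊢
    exact greedyInvariant_step hG hdisj hS₀ hS₁ hε hε1 hη hQnew hQη hTQ hopt hsel (by omega) hT hd

end Greedy

end OpinionMax

end

/-! ### Assembly of convergence, approximation ratio and probability. -/

theorem mainTheorem6 {V : Type*} [Fintype V] [DecidableEq V]
    (G : SimpleGraph V) (hG : G.Connected)
    (S₀ S₁ : Finset V) (hdisj : Disjoint S₀ S₁) (hS₀ : S₀.Nonempty) (hS₁ : S₁.Nonempty)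
    (hF : Nonempty (Follower S₀ S₁))
    (x₀ : V → ℝ)
    (ε η : ℝ) (hε₀ : 0 < ε) (hε₁ : ε < 1 / 2) (hη₀ : 1 / 2 < η) (hη₁ : η < 1)
    (Q : Finset (Cand S₀ S₁))
    (hQnew : ∀ e ∈ Q, ¬ G.Adj e.1.1 e.2.1)
    (hQη : ∀ e ∈ Q, stableOpinion G S₀ S₁ x₀ e.1.1 < η)
    (k : ℕ) (hk : k ≤ Q.card)
    (Solve : Solver (Follower S₀ S₁)) (p : ℝ) (hp : 0 ≤ p) (hSolve : IsSolver Solve p)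
    (sel : (R : Finset (Cand S₀ S₁)) → ({e : Cand S₀ S₁ // e ∈ R} → ℝ) → Cand S₀ S₁)
    (hsel : IsArgmaxRule sel)
    (Tstar : Finset (Cand S₀ S₁)) (hTQ : Tstar ⊆ Q) (hTk : Tstar.card = k)
    (hTopt : ∀ P ⊆ Q, P.card = k →
      overallOpinion G S₀ S₁ x₀ P ≤ overallOpinion G S₀ S₁ x₀ Tstar) :
    (∀ T ⊆ Q, ∀ v : V, ∃ l : ℝ,
      Tendsto (fun t : ℕ => opinion (addEdges G T) S₀ S₁ x₀ t v) atTop (𝓝 l)) ∧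
    1 - k * (4 / (Fintype.card (Follower S₀ S₁) : ℝ) ^ 3 +
        (2 * (sketchDim (Fintype.card (Follower S₀ S₁)) ε : ℝ) + 2) * p) ≤
      prob (approx Solve sel ε η G Q k)
        {T | T ⊆ Q ∧ T.card = k ∧
          overallOpinion G S₀ S₁ x₀ T - overallOpinion G S₀ S₁ x₀ ∅ ≥
            (1 - 1 / Real.exp 1 - ε) *
              (overallOpinion G S₀ S₁ x₀ Tstar - overallOpinion G S₀ S₁ x₀ ∅)} := by
  classical
  have hM := lapF_isStieltjes (S₁ := S₁) hG hS₀
  have hb : bVec G S₀ S₁ ≤ lapF G S₀ S₁ *ᵥ fun _ => 1 := by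
    rw [lapF_mulVec_one]; exact bVec_le_wVec G
  have hH : ∀ T ⊆ Q, overallOpinion G S₀ S₁ x₀ T =
      totalOpinion (lapF G S₀ S₁) (bVec G S₀ S₁) T := fun T hT =>
    overallOpinion_eq hG hdisj hS₀ x₀ fun e he => hQnew e (hT he)
  have hQη' : ∀ e ∈ Q, followerOpinion G S₀ S₁ e.1 < η := fun e he => by
    rw [← stableOpinion_follower hG hdisj hS₀ x₀]; exact hQη e he
  have hopt : ∀ P ⊆ Q, P.card = Tstar.card →
      totalOpinion (lapF G S₀ S₁) (bVec G S₀ S₁) P ≤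
        totalOpinion (lapF G S₀ S₁) (bVec G S₀ S₁) Tstar := fun P hPQ hP => by
    rw [← hH P hPQ, ← hH Tstar hTQ]; exact hTopt P hPQ (hP.trans hTk)
  refine ⟨fun T _ v => ⟨_, tendsto_opinion (addEdges_connected hG T) hdisj hS₀ x₀ v⟩, ?_⟩
  set C := 4 / (Fintype.card (Follower S₀ S₁) : ℝ) ^ 3 +
    (2 * (sketchDim (Fintype.card (Follower S₀ S₁)) ε : ℝ) + 2) * p
  have hC : 0 ≤ C := by positivity
  have hfail := approx_fail_le hG hdisj hS₀ hS₁ hε₀ hε₁ hη₁ hQnew hQη' hp hSolve hsel hTQ hopt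
    k hTk.ge
  refine le_prob_of_compl_le (by positivity) ?_
  rw [ENNReal.ofReal_mul (Nat.cast_nonneg k), ENNReal.ofReal_natCast]
  refine le_trans (MeasureTheory.measure_mono ?_) hfail
  intro T hT hinv
  refine hT ?_
  obtain ⟨hTsub, hTcard, -⟩ := id hinv
  refine ⟨hTsub, hTcard, ?_⟩
  rw [hH T hTsub, hH Tstar hTQ, hH ∅ (Finset.empty_subset Q)]
  -- For `k = 0` the invariant contains divisions by zero; the claim is trivial there, since both
  -- sets are empty.
  rcases Nat.eq_zero_or_pos k with h0 | h0
  · have e1 : T = ∅ := Finset.card_eq_zero.1 (hTcard.trans h0)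
    have e2 : Tstar = ∅ := Finset.card_eq_zero.1 (hTk.trans h0)
    rw [e1, e2]; simp
  · subst hTk
    exact greedyInvariant_final hε₀ hε₁ hdisj hS₀ hS₁ hM hb h0 hinv
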